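/- Let $a>1$ and $c\in\mathbb R\setminus\{0\}$, and let $M$ be the twice punctured torus $$M=\Bigl\{(z,w)\in(\mathbb C\cup\{\infty\})^2 : w^2=\frac{(z+1)(z-a)}{(z-1)(z+a)}\Bigr\}\setminus\{(\infty,1),(\infty,-1)\},$$ with $G=w$ and $Q=c\,dz\,dw/w$. Let $\varpi:\widetilde M\to M$ be the universal covering with a base point $\tilde x_0$ over $(0,1)$. A null lift is a holomorphic map $F:\widetilde M\to SL(2,\mathbb C)$ with $$dF\cdot F^{-1}=\begin{pmatrix}G&-G^2\\1&-G\end{pmatrix}\frac{Q}{dG},\qquad \frac{Q}{dG}=\frac{c\,dz}{w}.$$ It satisfies the $SU(1,1)$ condition if for every loop $\gamma$ in $M$ based at $(0,1)$ the monodromy matrix $\Phi_\gamma$, defined by $F\circ\tau=F\Phi_\gamma$ with $\tau$ the deck transformation associated to $\gamma$, lies in $SU(1,1)$. Let $c_1,c_2:[0,1]\to M$ be curves starting at $(0,1)$ whose projections to the $z$-plane are embedded curves in the open first quadrant except for their end points; the $z$-coordinate of $c_1(1)$ is real and lies in $(1,a)$, and that of $c_2(1)$ is real and lies in $(a,\infty)$.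 Let $E$ be the null lift with $E(\tilde x_0)$ the identity matrix, and for $j=1,2$ let $\begin{pmatrix}A_j&B_j\\C_j&D_j\end{pmatrix}$ be the value of $E$ at the end point of the lift of $c_j$ that starts at $\tilde x_0$. Assume that the denominators of $$f_1=-\frac{\bar A_1C_1+A_1\bar C_1+\bar B_1D_1+B_1\bar D_1}{\bar A_1D_1+A_1\bar D_1+\bar B_1C_1+B_1\bar C_1},\qquad f_2=-\frac{\bar A_2C_2-A_2\bar C_2+\bar B_2D_2-B_2\bar D_2}{\bar A_2D_2-A_2\bar D_2+\bar B_2C_2-B_2\bar C_2}$$ do not vanish. For $\varepsilon\in\{1,-1\}$ and $\alpha,\beta\in\mathbb C$ with $\alpha\beta=-\varepsilon/2$ let $F_{\varepsilon,\alpha,\beta}$ be the null lift with $$F_{\varepsilon,\alpha,\beta}(\tilde x_0)=P(\alpha,\beta)=\begin{pmatrix}\alpha&\varepsilon\beta\\\alpha&-\varepsilon\beta\end{pmatrix}.$$ (i) For all such $\varepsilon,\alpha,\beta$: if $f_1=f_2$, this number has absolute value greater than $1$, and it equals $\dfrac{1+4|\beta|^4}{1-4|\beta|^4}$, then $F_{\varepsilon,\alpha,\beta}$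 satisfies the $SU(1,1)$ condition. The converse holds if $\operatorname{Re}(\bar A_1C_1)\ne\operatorname{Re}(\bar B_1D_1)$. (ii) If $f_1=f_2$ and this number has absolute value greater than $1$, then there are $\varepsilon,\alpha,\beta$ as above such that $F_{\varepsilon,\alpha,\beta}$ satisfies the $SU(1,1)$ condition. The converse holds if $\operatorname{Re}(\bar A_1C_1)\ne\operatorname{Re}(\bar B_1D_1)$. -/

import Mathlib

open scoped Matrix OnePoint Topology unitInterval ComplexConjugate

noncomputable section

namespace GenusOneFace

/-- Squaring on `ℂ ∪ {∞}`. -/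
def sphereSq : OnePoint ℂ → OnePoint ℂ := OnePoint.map (fun w => w ^ 2)

/-- The rational function `z ↦ (z + 1)(z - a) / ((z - 1)(z + a))` from `ℂ ∪ {∞}` to itself
(for `1 < a` numerator and denominator have no common zero). -/
def ratFun (a : ℝ) (z : OnePoint ℂ) : OnePoint ℂ :=
  z.elim ((1 : ℂ) : OnePoint ℂ) fun z =>
    if (z - 1) * (z + a) = 0 then ∞
    else (((z + 1) * (z - a) / ((z - 1) * (z + a)) : ℂ) : OnePoint ℂ)

/-- The twice punctured torus
`{(z, w) ∈ (ℂ ∪ {∞})² | w² = (z + 1)(z - a) / ((z - 1)(z + a))} \ {(∞, 1), (∞, -1)}`,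
as a subspace of `(ℂ ∪ {∞})²`. -/
def M (a : ℝ) : Set (OnePoint ℂ × OnePoint ℂ) :=
  {p | sphereSq p.2 = ratFun a p.1} \ {(∞, ((1 : ℂ) : OnePoint ℂ)), (∞, ((-1 : ℂ) : OnePoint ℂ))}

/-- The finite value of a point of `ℂ ∪ {∞}` (with value `0` at `∞`). -/
def finiteValue (z : OnePoint ℂ) : ℂ := z.elim 0 id

/-- The function `w ↦ 1 / w` near `∞`, with value `0` at `∞`. -/
def recip (w : OnePoint ℂ) : ℂ := w.elim 0 fun w => w⁻¹

/-- The coordinate function `z` on `M`; it is finite on `M` because the two points over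
`z = ∞` are removed. -/
def zCoord {a : ℝ} (p : M a) : ℂ := finiteValue p.1.1

/-- The function `w` on `M`, used where it is finite. -/
def wCoord {a : ℝ} (p : M a) : ℂ := finiteValue p.1.2

/-- `w(p)` is neither `0` nor `∞`, i.e. `p` does not lie over one of `z = ±1, ±a`. At these
points `z` is a local coordinate of `M`. -/
def IsUnbranched {a : ℝ} (p : M a) : Prop := p.1.2 ≠ ∞ ∧ p.1.2 ≠ ((0 : ℂ) : OnePoint ℂ)

open Classical in
/-- The holomorphic coordinate of the Riemann surface `M` around `p`, as a function of `q`
near `p`: it is `1 / w` if `w(p) = ∞`, it is `w` if `w(p) = 0`, and it is `z` otherwise. -/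
def localCoord {a : ℝ} (p q : M a) : ℂ :=
  if p.1.2 = ∞ then recip q.1.2
  else if p.1.2 = ((0 : ℂ) : OnePoint ℂ) then wCoord q
  else zCoord q

/-- The coefficient of `dz` in the matrix-valued `1`-form
`[[G, -G²], [1, -G]] · Q / dG` for `G = w` and `Q = c dz dw / w`, so that `Q / dG = (c / w) dz`. -/
def nullForm (c : ℝ) (w : ℂ) : Matrix (Fin 2) (Fin 2) ℂ :=
  (c / w : ℂ) • !![w, -w ^ 2; 1, -w]

/-- The matrix `e₃ = diag(1, -1)`. -/
def e₃ : Matrix (Fin 2) (Fin 2) ℂ := !![1, 0; 0, -1]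

/-- The group `SU(1,1)`: matrices of determinant one that preserve the Hermitian form `e₃`. -/
def SU11 : Set (Matrix.SpecialLinearGroup (Fin 2) ℂ) :=
  {Φ | Φ.1ᴴ * e₃ * Φ.1 = e₃}

section Cover

variable {a : ℝ} {X : Type*} [TopologicalSpace X]

/-- `F` is a holomorphic null lift for the data `G = w`, `Q = c dz dw / w`: a holomorphic map
to `SL(2, ℂ)` on a covering `ϖ : X → M` with `dF · F⁻¹ = [[G, -G²], [1, -G]] Q / dG`.
Around every `x`, `F` is an analytic function `g` of the local coordinate of `M` at `ϖ x`;
the differential equation is written in the coordinate `z` off the (discrete) set of points over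
`z = ±1, ±a`, and hence holds on all of `X`, both sides being holomorphic there. -/
def IsNullLift (c : ℝ) (ϖ : X → M a) (F : X → Matrix.SpecialLinearGroup (Fin 2) ℂ) : Prop :=
  ∀ x : X, ∃ g : ℂ → Matrix (Fin 2) (Fin 2) ℂ,
    (∀ i j, AnalyticAt ℂ (fun t => g t i j) (localCoord (ϖ x) (ϖ x))) ∧
    (∀ᶠ y in 𝓝 x, (F y).1 = g (localCoord (ϖ x) (ϖ y))) ∧
    (IsUnbranched (ϖ x) → ∀ i j, HasDerivAt (fun t => g t i j)
      ((nullForm c (wCoord (ϖ x)) * (F x).1) i j) (zCoord (ϖ x)))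

/-- `τ` is the deck transformation associated to the loop `γ`: it moves the base point `x₀` to
the end point of the lift of `γ` that starts at `x₀`. -/
def IsDeckTransformationOf (ϖ : X → M a) (x₀ : X) (γ : Path (ϖ x₀) (ϖ x₀)) (τ : X ≃ₜ X) : Prop :=
  (∀ x, ϖ (τ x) = ϖ x) ∧ ∃ Γ : Path x₀ (τ x₀), ∀ t, ϖ (Γ t) = γ t

/-- `Φ` is the monodromy matrix of `F` with respect to the loop `γ`: `F ∘ τ = F Φ`. -/
def IsMonodromy (ϖ : X → M a) (x₀ : X) (F : X → Matrix.SpecialLinearGroup (Fin 2) ℂ)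
    (γ : Path (ϖ x₀) (ϖ x₀)) (Φ : Matrix.SpecialLinearGroup (Fin 2) ℂ) : Prop :=
  ∃ τ : X ≃ₜ X, IsDeckTransformationOf ϖ x₀ γ τ ∧ ∀ x, F (τ x) = F x * Φ

/-- The `SU(1,1)` condition: the monodromy matrix of every loop in `M` lies in `SU(1,1)`. -/
def SatisfiesSU11 (ϖ : X → M a) (x₀ : X) (F : X → Matrix.SpecialLinearGroup (Fin 2) ℂ) : Prop :=
  ∀ γ : Path (ϖ x₀) (ϖ x₀), ∃ Φ ∈ SU11, IsMonodromy ϖ x₀ F γ Φ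

end Cover

/-- A curve in `M` that starts at `(0, 1)`, whose projection to the `z`-plane is an embedded curve
in the (open) first quadrant, apart from its start `z = 0` and its end point, which is real. -/
structure IsQuadrantCurve {a : ℝ} (γ : C(I, M a)) : Prop where
  start : (γ 0).1 = (((0 : ℂ) : OnePoint ℂ), ((1 : ℂ) : OnePoint ℂ))
  embedded : Function.Injective fun t => zCoord (γ t)
  quadrant : ∀ t : I, t ≠ 0 → t ≠ 1 → 0 < (zCoord (γ t)).re ∧ 0 < (zCoord (γ t)).im
  end_real : (zCoord (γ 1)).im = 0

/-- The initial value `P(α, β)`. -/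
def initialP (ε : ℝ) (α β : ℂ) : Matrix (Fin 2) (Fin 2) ℂ :=
  !![α, ε * β; α, -(ε * β)]

/-- The denominator of `f₁`, for `[[A, B], [C, D]]`. -/
def den₁ (E : Matrix (Fin 2) (Fin 2) ℂ) : ℂ :=
  conj (E 0 0) * E 1 1 + E 0 0 * conj (E 1 1) + conj (E 0 1) * E 1 0 + E 0 1 * conj (E 1 0)

/-- The denominator of `f₂`, for `[[A, B], [C, D]]`. -/
def den₂ (E : Matrix (Fin 2) (Fin 2) ℂ) : ℂ :=
  conj (E 0 0) * E 1 1 - E 0 0 * conj (E 1 1) + conj (E 0 1) * E 1 0 - E 0 1 * conj (E 1 0)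

/-- The expression `f₁`, for `[[A, B], [C, D]]`. -/
def f₁ (E : Matrix (Fin 2) (Fin 2) ℂ) : ℂ :=
  -((conj (E 0 0) * E 1 0 + E 0 0 * conj (E 1 0) + conj (E 0 1) * E 1 1 + E 0 1 * conj (E 1 1)) /
    den₁ E)

/-- The expression `f₂`, for `[[A, B], [C, D]]`. -/
def f₂ (E : Matrix (Fin 2) (Fin 2) ℂ) : ℂ :=
  -((conj (E 0 0) * E 1 0 - E 0 0 * conj (E 1 0) + conj (E 0 1) * E 1 1 - E 0 1 * conj (E 1 1)) /
    den₂ E)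

end GenusOneFace

end

/-! Put H = F e₃ F*. A deck transformation replaces F by F Φ, so all monodromy matrices lie in
SU(1,1) exactly when H is constant on the fibres of the covering (`satisfiesSU11_iff`). Null lifts
are unique up to a constant right factor, so F = E P(α, β) and H = E m E*, where m = P e₃ P* is real
with both diagonal entries p = |α|² - |β|² and both off-diagonal entries q = |α|² + |β|². Here q² -
p² = 1 and q/p = (1 + 4|β|⁴)/(1 - 4|β|⁴). For p ≠ 0, f₁ = q/p says that H₀₁ is imaginary at the end
of the first lift, and f₂ = q/p that it is real at the end of the second. It remains to relate these
two conditions to the descent of H. A lift of a symmetry of the torus, followed by the matching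
automorphism of matrices, turns E into another null lift; hence it turns E m E* into some E k E*
with k constant, and one point decides whether k = m (`CurveSymmetry.act_hermitian_eq`). Sufficiency
(`descends_of_period_conditions`): the closed upper half-plane lifts to one tile, whose four images
under (z, w) ↦ (z, ±w), (z̄, ±w̄) cover the torus. The points ±1, ±a cut the real axis into segments
fixed pointwise by (z̄, w̄) or by (z̄, -w̄), and invariance of H at one point spreads along a
segment. The base point serves [-1, 1], the two conditions serve [1, a] and [a, ∞), and (z, w) ↦
(-z̄, 1/w̄) transfers the result to negative z. So H on the tile extends by reflection to a
single-valued function on the torus, and a clopen argument identifies it with H. Necessity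
(`period_conditions_of_descends`): if H descends, the lift of conjugation fixing the base point
gives the condition at the second end point. At the first, the lift of (z̄, -w̄) fixing that point
produces a second matrix k of the same shape as m, and the assumption Re(ĀC) ≠ Re(B̄D) forces k = m
(`eq_of_mul_symmMatrix_mul`). -/

noncomputable section

/-! ### The affine model of the twice punctured torus. -/

namespace GenusOneFace

/-- The affine model `y² = (z² - 1)(z² - a²)` of the twice punctured torus. -/
def Curve (a : ℝ) : Set (ℂ × ℂ) := {p | p.2 ^ 2 = (p.1 ^ 2 - 1) * (p.1 ^ 2 - (a : ℂ) ^ 2)}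

namespace Curve

variable {a : ℝ}

/-- The numerator of `w²` as a function of `z`. -/
def num (a : ℝ) (z : ℂ) : ℂ := (z + 1) * (z - a)

/-- The denominator of `w²` as a function of `z`. -/
def den (a : ℝ) (z : ℂ) : ℂ := (z - 1) * (z + a)

/-- The coordinate `z`. -/
def z (p : Curve a) : ℂ := p.1.1

/-- The coordinate `y`. -/
def y (p : Curve a) : ℂ := p.1.2

@[ext] theorem ext {p q : Curve a} (hz : z p = z q) (hy : y p = y q) : p = q :=
  Subtype.ext (Prod.ext hz hy)

theorem continuous_z : Continuous (z : Curve a → ℂ) := continuous_fst.comp continuous_subtype_val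

theorem continuous_y : Continuous (y : Curve a → ℂ) := continuous_snd.comp continuous_subtype_val

theorem y_sq (p : Curve a) : y p ^ 2 = num a (z p) * den a (z p) := by
  have h : y p ^ 2 = (z p ^ 2 - 1) * (z p ^ 2 - (a : ℂ) ^ 2) := p.2
  rw [h, num, den]; ring

theorem y_eq_zero_iff (p : Curve a) : y p = 0 ↔ num a (z p) = 0 ∨ den a (z p) = 0 := by
  rw [← mul_eq_zero, ← y_sq, sq_eq_zero_iff]

theorem den_eq_of_num_eq_zero (ha : 1 < a) {z : ℂ} (h : num a z = 0) : den a z ≠ 0 := by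
  have ha' : (a : ℂ) ≠ 0 := by exact_mod_cast (by linarith : a ≠ 0)
  have h1 : (a : ℂ) - 1 ≠ 0 := by
    rw [sub_ne_zero]; exact_mod_cast (by linarith : a ≠ 1)
  have h2 : (a : ℂ) - (-1) ≠ 0 := by
    rw [sub_ne_zero]; exact_mod_cast (by linarith : a ≠ -1)
  rcases mul_eq_zero.1 h with h | h
  · have : z = -1 := by linear_combination h
    subst this
    refine mul_ne_zero (by norm_num) ?_
    intro h; apply h1; linear_combination h
  · have : z = a := by linear_combination h
    subst this
    refine mul_ne_zero h1 ?_
    intro h; apply ha'; linear_combination h / 2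

theorem num_ne_of_den_eq_zero (ha : 1 < a) {z : ℂ} (h : den a z = 0) : num a z ≠ 0 :=
  fun h' => den_eq_of_num_eq_zero ha h' h

/-- The value of `w` at a point of the affine model. -/
def w (p : Curve a) : OnePoint ℂ :=
  open Classical in if den a (z p) = 0 then ∞ else ((y p / den a (z p) : ℂ) : OnePoint ℂ)

theorem w_of_den_eq_zero {p : Curve a} (h : den a (z p) = 0) : w p = ∞ := if_pos h

theorem w_of_den_ne_zero {p : Curve a} (h : den a (z p) ≠ 0) :
    w p = ((y p / den a (z p) : ℂ) : OnePoint ℂ) := if_neg h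

theorem finiteValue_w (p : Curve a) : finiteValue (w p) = y p / den a (z p) := by
  by_cases h : den a (z p) = 0
  · rw [w_of_den_eq_zero h, h, div_zero]; rfl
  · rw [w_of_den_ne_zero h]; rfl

theorem recip_w (p : Curve a) : recip (w p) = den a (z p) / y p := by
  by_cases h : den a (z p) = 0
  · rw [w_of_den_eq_zero h, h, zero_div]; rfl
  · rw [w_of_den_ne_zero h, ← inv_div (y p)]; rfl

theorem w_eq_infty_iff (p : Curve a) : w p = ∞ ↔ den a (z p) = 0 := by
  refine ⟨fun h => ?_, w_of_den_eq_zero⟩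
  by_contra h'
  rw [w_of_den_ne_zero h'] at h
  exact OnePoint.coe_ne_infty _ h

theorem w_eq_zero_iff (ha : 1 < a) (p : Curve a) :
    w p = ((0 : ℂ) : OnePoint ℂ) ↔ num a (z p) = 0 := by
  by_cases h : den a (z p) = 0
  · rw [w_of_den_eq_zero h]
    exact ⟨fun h' => (OnePoint.infty_ne_coe _ h').elim,
      fun h' => (num_ne_of_den_eq_zero ha h h').elim⟩
  · rw [w_of_den_ne_zero h, OnePoint.coe_eq_coe, div_eq_zero_iff, y_eq_zero_iff]
    tauto

/-- Since y² = num · den and w = y / den, this formula and the next recover y from (z, w). One is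
used near w = ∞ and the other near finite w, to see that the inverse of `toM` is continuous. -/
theorem y_eq_num_mul (p : Curve a) : y p = num a (z p) * recip (w p) := by
  rw [recip_w, ← mul_div_assoc, ← y_sq, sq, mul_self_div_self]

theorem y_eq_den_mul (p : Curve a) : y p = den a (z p) * finiteValue (w p) := by
  rw [finiteValue_w]
  by_cases h : den a (z p) = 0
  · rw [h, zero_mul, y_eq_zero_iff]; exact Or.inr h
  · field_simp

/-- The map from the affine model to `M a`. -/
def toM (p : Curve a) : M a := ⟨(((z p : ℂ) : OnePoint ℂ), w p), by
  refine ⟨?_, ?_⟩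
  · change sphereSq (w p) = if den a (z p) = 0 then ∞ else ((num a (z p) / den a (z p) : ℂ) : OnePoint ℂ)
    by_cases h : den a (z p) = 0
    · rw [w_of_den_eq_zero h, if_pos h]; rfl
    · rw [w_of_den_ne_zero h, if_neg h]
      change (((y p / den a (z p)) ^ 2 : ℂ) : OnePoint ℂ) = _
      rw [div_pow, y_sq]
      congr 1
      field_simp
  · simp⟩

theorem zCoord_toM (p : Curve a) : zCoord (toM p) = z p := rfl

theorem toM_snd (p : Curve a) : (toM p).1.2 = w p := rfl

theorem wCoord_toM (p : Curve a) : wCoord (toM p) = y p / den a (z p) := finiteValue_w p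

theorem isUnbranched_toM (ha : 1 < a) (p : Curve a) : IsUnbranched (toM p) ↔ y p ≠ 0 := by
  rw [IsUnbranched, toM_snd, Ne, Ne, w_eq_infty_iff, w_eq_zero_iff ha, Ne, y_eq_zero_iff]
  tauto

theorem toM_injective : Function.Injective (toM : Curve a → M a) := by
  intro p q h
  have h1 : z p = z q := congrArg zCoord h
  have h2 : w p = w q := congrArg (fun m => m.1.2) h
  exact ext h1 (by rw [y_eq_den_mul p, y_eq_den_mul q, h1, h2])

theorem toM_surjective : Function.Surjective (toM : Curve a → M a) := by
  rintro ⟨⟨u, v⟩, h1, h2⟩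
  change sphereSq v = ratFun a u at h1
  induction u using OnePoint.rec with
  | infty =>
    exfalso
    change sphereSq v = ((1 : ℂ) : OnePoint ℂ) at h1
    induction v using OnePoint.rec with
    | infty => exact OnePoint.infty_ne_coe _ h1
    | coe v =>
      change ((v ^ 2 : ℂ) : OnePoint ℂ) = _ at h1
      rw [OnePoint.coe_eq_coe, ← one_pow 2, sq_eq_sq_iff_eq_or_eq_neg] at h1
      rcases h1 with rfl | rfl <;> simp at h2
  | coe u =>
    change sphereSq v = if den a u = 0 then ∞ else ((num a u / den a u : ℂ) : OnePoint ℂ) at h1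
    induction v using OnePoint.rec with
    | infty =>
      by_cases h : den a u = 0
      · refine ⟨⟨(u, 0), ?_⟩, ?_⟩
        · change (0 : ℂ) ^ 2 = (u ^ 2 - 1) * (u ^ 2 - (a : ℂ) ^ 2)
          rw [den] at h
          linear_combination -((u + 1) * (u - a)) * h
        · apply Subtype.ext
          exact Prod.ext rfl (w_of_den_eq_zero h)
      · rw [if_neg h] at h1
        exact (OnePoint.infty_ne_coe _ h1).elim
    | coe v =>
      change ((v ^ 2 : ℂ) : OnePoint ℂ) = _ at h1
      by_cases h : den a u = 0
      · rw [if_pos h] at h1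
        exact (OnePoint.coe_ne_infty _ h1).elim
      · rw [if_neg h, OnePoint.coe_eq_coe, eq_div_iff h] at h1
        refine ⟨⟨(u, v * den a u), ?_⟩, ?_⟩
        · change (v * den a u) ^ 2 = (u ^ 2 - 1) * (u ^ 2 - (a : ℂ) ^ 2)
          have : (u ^ 2 - 1) * (u ^ 2 - (a : ℂ) ^ 2) = num a u * den a u := by
            rw [num, den]; ring
          rw [this, ← h1]; ring
        · apply Subtype.ext
          refine Prod.ext rfl ((w_of_den_ne_zero h).trans ?_)
          change ((v * den a u / den a u : ℂ) : OnePoint ℂ) = v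
          rw [mul_div_cancel_right₀ _ h]

theorem continuousAt_finiteValue (u : ℂ) : ContinuousAt finiteValue (u : OnePoint ℂ) :=
  OnePoint.continuousAt_coe.2 continuousAt_id

theorem continuousAt_recip_infty : ContinuousAt recip ∞ := by
  rw [OnePoint.continuousAt_infty', Filter.coclosedCompact_eq_cocompact,
    ← Metric.cobounded_eq_cocompact]
  exact Filter.tendsto_inv₀_cobounded

theorem continuous_toM (ha : 1 < a) : Continuous (toM : Curve a → M a) := by
  have hd : Continuous fun p : Curve a => den a (z p) :=
    (continuous_z.sub continuous_const).mul (continuous_z.add continuous_const)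
  have hn : Continuous fun p : Curve a => num a (z p) :=
    (continuous_z.add continuous_const).mul (continuous_z.sub continuous_const)
  refine Continuous.subtype_mk (Continuous.prodMk (OnePoint.continuous_coe.comp continuous_z) ?_) _
  rw [continuous_iff_continuousAt]
  intro p
  by_cases h : den a (z p) = 0
  · have hnum := num_ne_of_den_eq_zero ha h
    have hy : y p = 0 := (y_eq_zero_iff p).2 (Or.inr h)
    classical
    -- Near a pole, 1 / w = y / num is regular; `f` is the inversion into the sphere, so w = f (y /
    -- num).
    let f : ℂ → OnePoint ℂ := fun u => if u = 0 then ∞ else ((u⁻¹ : ℂ) : OnePoint ℂ)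
    have hf : ContinuousAt f 0 := by
      rw [continuousAt_iff_punctured_nhds]
      have h0 : f 0 = ∞ := if_pos rfl
      rw [h0]
      have h1 : Filter.Tendsto (fun u : ℂ => ((u⁻¹ : ℂ) : OnePoint ℂ)) (𝓝[≠] 0) (𝓝 ∞) := by
        refine Filter.Tendsto.comp ?_ Filter.tendsto_inv₀_nhdsNE_zero
        rw [Metric.cobounded_eq_cocompact, ← Filter.coclosedCompact_eq_cocompact]
        exact OnePoint.tendsto_coe_infty
      refine h1.congr' ?_
      filter_upwards [self_mem_nhdsWithin] with u hu
      exact (if_neg hu).symm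
    have hg : ContinuousAt (fun q : Curve a => y q / num a (z q)) p :=
      continuous_y.continuousAt.div hn.continuousAt hnum
    have hfg : ContinuousAt (fun q : Curve a => f (y q / num a (z q))) p :=
      ContinuousAt.comp (g := f) (by rw [hy, zero_div]; exact hf) hg
    refine hfg.congr ?_
    filter_upwards [hn.continuousAt.eventually_ne hnum] with q hq
    by_cases hq' : den a (z q) = 0
    · rw [w_of_den_eq_zero hq']
      exact if_pos (by rw [(y_eq_zero_iff q).2 (Or.inr hq'), zero_div])
    · have hyq : y q ≠ 0 := by rw [Ne, y_eq_zero_iff]; tauto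
      rw [w_of_den_ne_zero hq']
      refine (if_neg (div_ne_zero hyq hq)).trans ?_
      congr 1
      rw [inv_div, div_eq_div_iff hyq hq', ← y_sq, sq]
  · have h1 : ContinuousAt (fun q : Curve a => ((y q / den a (z q) : ℂ) : OnePoint ℂ)) p :=
      OnePoint.continuous_coe.continuousAt.comp (continuous_y.continuousAt.div hd.continuousAt h)
    refine h1.congr ?_
    filter_upwards [hd.continuousAt.eventually_ne h] with q hq
    exact (w_of_den_ne_zero hq).symm

/-- The affine model is homeomorphic to `M a`. -/
def homeo (ha : 1 < a) : Curve a ≃ₜ M a where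
  toEquiv := Equiv.ofBijective toM ⟨toM_injective, toM_surjective⟩
  continuous_toFun := continuous_toM ha
  continuous_invFun := by
    set s := (Equiv.ofBijective (toM : Curve a → M a) ⟨toM_injective, toM_surjective⟩).symm with hs
    have hs' : ∀ m, toM (s m) = m := fun m => Equiv.ofBijective_apply_symm_apply _ _ m
    have hz : ∀ m, z (s m) = zCoord m := fun m => congrArg zCoord (hs' m)
    have hw : ∀ m, w (s m) = m.1.2 := fun m => congrArg (fun m => m.1.2) (hs' m)
    have hzc : Continuous fun m => z (s m) := by
      rw [continuous_iff_continuousAt]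
      intro m
      have : ContinuousAt finiteValue m.1.1 := by
        rw [← hs' m]; exact continuousAt_finiteValue _
      simp only [hz]
      exact this.comp (f := fun m : M a => m.1.1)
        (continuous_fst.comp continuous_subtype_val).continuousAt
    have hwc : Continuous fun m : M a => m.1.2 := continuous_snd.comp continuous_subtype_val
    have hd : Continuous fun m => den a (z (s m)) :=
      (hzc.sub continuous_const).mul (hzc.add continuous_const)
    have hn : Continuous fun m => num a (z (s m)) :=
      (hzc.add continuous_const).mul (hzc.sub continuous_const)
    have hyc : Continuous fun m => y (s m) := by
      rw [continuous_iff_continuousAt]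
      intro m
      by_cases h : m.1.2 = ∞
      · have h1 : ContinuousAt (fun m : M a => recip m.1.2) m := by
          refine ContinuousAt.comp (g := recip) ?_ hwc.continuousAt
          rw [h]; exact continuousAt_recip_infty
        refine (hn.continuousAt.mul h1).congr (Filter.Eventually.of_forall fun q => ?_)
        change _ = y (s q)
        rw [y_eq_num_mul, hw]; rfl
      · obtain ⟨u, hu⟩ := OnePoint.ne_infty_iff_exists.1 h
        have h1 : ContinuousAt (fun m : M a => finiteValue m.1.2) m := by
          refine ContinuousAt.comp (g := finiteValue) ?_ hwc.continuousAt
          rw [← hu]; exact continuousAt_finiteValue _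
        refine (hd.continuousAt.mul h1).congr (Filter.Eventually.of_forall fun q => ?_)
        change _ = y (s q)
        rw [y_eq_den_mul, hw]; rfl
    exact Continuous.subtype_mk (hzc.prodMk hyc) _

open Classical in
/-- The holomorphic coordinate around `p` as a function of `q`. -/
def coord (p q : Curve a) : ℂ :=
  if den a (z p) = 0 then den a (z q) / y q
  else if num a (z p) = 0 then y q / den a (z q)
  else z q

theorem localCoord_toM (ha : 1 < a) (p q : Curve a) :
    localCoord (toM p) (toM q) = coord p q := by
  unfold localCoord coord
  simp only [toM_snd, w_eq_infty_iff, w_eq_zero_iff ha, recip_w, wCoord_toM, zCoord_toM]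

theorem coord_of_y_ne_zero {p : Curve a} (h : y p ≠ 0) (q : Curve a) : coord p q = z q := by
  rw [Ne, y_eq_zero_iff, not_or] at h
  rw [coord, if_neg h.2, if_neg h.1]

end Curve

end GenusOneFace

/-! ### Square roots and the charts given by the local coordinates. -/

namespace GenusOneFace

theorem sqrt_sq (u : ℂ) : u.sqrt ^ 2 = u := by
  simp [Complex.sqrt]

theorem sqrt_re_nonneg (u : ℂ) : 0 ≤ u.sqrt.re := by
  rw [Complex.sqrt, Complex.cpow_inv_two_re]; positivity

theorem sqrt_re_pos {u : ℂ} (hu : u ∈ Complex.slitPlane) : 0 < u.sqrt.re := by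
  refine (sqrt_re_nonneg u).lt_of_ne fun h => ?_
  have h2 := sqrt_sq u
  have hre := congrArg Complex.re h2
  have him := congrArg Complex.im h2
  simp only [sq, Complex.mul_re, Complex.mul_im, ← h, zero_mul, mul_zero, add_zero, zero_sub]
    at hre him
  rcases hu with hu | hu
  · nlinarith [mul_self_nonneg u.sqrt.im]
  · exact hu him.symm

theorem eq_sqrt_of_sq_eq {u v : ℂ} (h : v ^ 2 = u) (hv : 0 < v.re) : v = u.sqrt := by
  rw [← sqrt_sq u, sq_eq_sq_iff_eq_or_eq_neg] at h
  rcases h with h | h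
  · exact h
  · have := sqrt_re_nonneg u
    rw [h, Complex.neg_re] at hv
    linarith

theorem continuousOn_sqrt : ContinuousOn Complex.sqrt Complex.slitPlane := fun _ hu =>
  (continuousAt_cpow_const hu).continuousWithinAt

namespace Curve

variable {a : ℝ}

/-- A chart from an explicit inverse u ↦ (Z u, Y u). The point `p` is only the junk value of the
inverse outside `V`. -/
theorem exists_chart_of_inverse {S : Set (Curve a)} {V : Set ℂ} (hS : IsOpen S) (hV : IsOpen V)
    {f : Curve a → ℂ} (hf : ContinuousOn f S) {Z Y : ℂ → ℂ} (hZ : ContinuousOn Z V)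
    (hY : ContinuousOn Y V) (hm : ∀ u ∈ V, (Z u, Y u) ∈ Curve a)
    (hmap : ∀ q ∈ S, f q ∈ V ∧ Z (f q) = z q ∧ Y (f q) = y q)
    (hinv : ∀ u (hu : u ∈ V), (⟨(Z u, Y u), hm u hu⟩ : Curve a) ∈ S ∧
      f ⟨(Z u, Y u), hm u hu⟩ = u) (p : Curve a) :
    ∃ e : OpenPartialHomeomorph (Curve a) ℂ, e.source = S ∧ ∀ q, e q = f q := by
  classical
  let ψ : ℂ → Curve a := fun u => if h : u ∈ V then ⟨(Z u, Y u), hm u h⟩ else p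
  have hψ : ∀ u (hu : u ∈ V), ψ u = ⟨(Z u, Y u), hm u hu⟩ := fun u hu => dif_pos hu
  refine ⟨{ toFun := f, invFun := ψ, source := S, target := V
            map_source' := fun q hq => (hmap q hq).1
            map_target' := fun u hu => by rw [hψ u hu]; exact (hinv u hu).1
            left_inv' := fun q hq => by
              rw [hψ _ (hmap q hq).1]
              exact ext (hmap q hq).2.1 (hmap q hq).2.2
            right_inv' := fun u hu => by rw [hψ u hu]; exact (hinv u hu).2
            open_source := hS
            open_target := hV
            continuousOn_toFun := hf
            continuousOn_invFun := ?_ }, rfl, fun q => rfl⟩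
  rw [Topology.IsInducing.subtypeVal.continuousOn_iff]
  exact (hZ.prodMk hY).congr fun u hu => by simp [hψ u hu]

theorem exists_chart_of_y_ne_zero {p : Curve a} (hp : y p ≠ 0) :
    ∃ e : OpenPartialHomeomorph (Curve a) ℂ, p ∈ e.source ∧ ∀ q ∈ e.source, e q = coord p q := by
  -- Normalised so that y / y(p) is a square root of D(z) equal to 1 at p; positive real part then
  -- singles out the principal root.
  let D : ℂ → ℂ := fun u => (u ^ 2 - 1) * (u ^ 2 - (a : ℂ) ^ 2) / y p ^ 2
  have hDc : Continuous D := by fun_prop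
  have hD : ∀ q : Curve a, (y q / y p) ^ 2 = D (z q) := fun q => by
    rw [div_pow, show y q ^ 2 = (z q ^ 2 - 1) * (z q ^ 2 - (a : ℂ) ^ 2) from q.2]
  have hV : IsOpen (D ⁻¹' Complex.slitPlane) := Complex.isOpen_slitPlane.preimage hDc
  have hy' : Continuous fun q : Curve a => (y q / y p).re :=
    Complex.continuous_re.comp (continuous_y.div_const _)
  have hmem : p ∈ z ⁻¹' (D ⁻¹' Complex.slitPlane) ∩ {q : Curve a | 0 < (y q / y p).re} := by
    refine ⟨?_, ?_⟩
    · change D (z p) ∈ Complex.slitPlane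
      rw [← hD, div_self hp, one_pow]; exact Complex.one_mem_slitPlane
    · change 0 < (y p / y p).re
      rw [div_self hp]; exact one_pos
  obtain ⟨e, he, he'⟩ := exists_chart_of_inverse
    (S := z ⁻¹' (D ⁻¹' Complex.slitPlane) ∩ {q : Curve a | 0 < (y q / y p).re})
    (V := D ⁻¹' Complex.slitPlane) (f := z) (Z := id) (Y := fun u => y p * (D u).sqrt)
    ((hV.preimage continuous_z).inter (isOpen_lt continuous_const hy')) hV
    continuous_z.continuousOn continuousOn_id
    (continuousOn_const.mul (continuousOn_sqrt.comp hDc.continuousOn fun _ h => h))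
    (fun u _ => by
      change (y p * (D u).sqrt) ^ 2 = (u ^ 2 - 1) * (u ^ 2 - (a : ℂ) ^ 2)
      rw [mul_pow, sqrt_sq, mul_div_cancel₀]
      exact pow_ne_zero 2 hp)
    (fun q hq => ⟨hq.1, rfl, by
      rw [← eq_sqrt_of_sq_eq (hD q) hq.2]
      field_simp⟩)
    (fun u hu => ⟨⟨hu, by
      change 0 < (y p * (D u).sqrt / y p).re
      rw [mul_div_cancel_left₀ _ hp]
      exact sqrt_re_pos hu⟩, rfl⟩) p
  exact ⟨e, he ▸ hmem, fun q _ => (he' q).trans (coord_of_y_ne_zero hp q).symm⟩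

theorem exists_chart_of_num_eq_zero (ha : 1 < a) {p : Curve a} (hp : num a (z p) = 0) :
    ∃ e : OpenPartialHomeomorph (Curve a) ℂ, p ∈ e.source ∧
      ∀ q ∈ e.source, den a (z q) ≠ 0 ∧ e q = y q / den a (z q) := by
  have hb : (a : ℂ) - 1 ≠ 0 := by
    rw [sub_ne_zero]; exact_mod_cast (by linarith : a ≠ 1)
  have hc : (a : ℂ) + 1 ≠ 0 := by exact_mod_cast (by linarith : a + 1 ≠ 0)
  have ha0 : (a : ℂ) ≠ 0 := by exact_mod_cast (by linarith : a ≠ 0)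
  -- The sign ε tells the two zeros of w apart: ε = 1 for z = a and ε = -1 for z = -1.
  obtain ⟨ε, hε, hεp⟩ : ∃ ε : ℂ, ε ^ 2 = 1 ∧ 2 * z p - (a - 1) = ε * (a + 1) := by
    rcases mul_eq_zero.1 hp with h | h
    · exact ⟨-1, by norm_num, by linear_combination 2 * h⟩
    · exact ⟨1, by norm_num, by linear_combination 2 * h⟩
  have hd : Continuous fun q : Curve a => den a (z q) :=
    (continuous_z.sub continuous_const).mul (continuous_z.add continuous_const)
  -- For u² ≠ 1, the equation num = u² den for z is z² - ζ(u) z - a = 0. Its discriminant ζ² + 4a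
  -- equals (a + 1)² at u = 0, so dividing by (a + 1)² makes D(0) = 1 and the principal root
  -- available.
  let ζ : ℂ → ℂ := fun u => (a - 1) * (1 + u ^ 2) / (1 - u ^ 2)
  let D : ℂ → ℂ := fun u => (ζ u ^ 2 + 4 * a) / (a + 1) ^ 2
  let V₀ : Set ℂ := {u | 1 - u ^ 2 ≠ 0}
  have hV₀ : IsOpen V₀ := isOpen_ne_fun (by fun_prop) continuous_const
  have hζ : ContinuousOn ζ V₀ := by
    refine ContinuousOn.div (by fun_prop) (by fun_prop) fun u hu => hu
  have hDc : ContinuousOn D V₀ := by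
    refine ContinuousOn.div_const ?_ _
    exact (hζ.pow 2).add continuousOn_const
  let V : Set ℂ := V₀ ∩ D ⁻¹' Complex.slitPlane
  have hV : IsOpen V := hDc.isOpen_inter_preimage hV₀ Complex.isOpen_slitPlane
  let f : Curve a → ℂ := fun q => y q / den a (z q)
  let S₀ : Set (Curve a) := {q | den a (z q) ≠ 0}
  have hS₀ : IsOpen S₀ := isOpen_ne_fun hd continuous_const
  have hf : ContinuousOn f S₀ := continuous_y.continuousOn.div hd.continuousOn fun q hq => hq
  let S₁ : Set (Curve a) := S₀ ∩ f ⁻¹' V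
  have hS₁ : IsOpen S₁ := hf.isOpen_inter_preimage hS₀ hV
  let g : Curve a → ℂ := fun q => (2 * z q - ζ (f q)) * ε / (a + 1)
  have hg : ContinuousOn g S₁ := by
    refine ContinuousOn.div_const (ContinuousOn.mul (ContinuousOn.sub ?_ ?_) continuousOn_const) _
    · exact (continuous_const.mul continuous_z).continuousOn
    · exact hζ.comp (hf.mono Set.inter_subset_left) fun q hq => hq.2.1
  let S : Set (Curve a) := S₁ ∩ g ⁻¹' {u | 0 < u.re}
  have hS : IsOpen S := hg.isOpen_inter_preimage hS₁
    (isOpen_lt continuous_const Complex.continuous_re)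
  have hyp : y p = 0 := (y_eq_zero_iff p).2 (Or.inl hp)
  have hfp : f p = 0 := by simp only [f, hyp, zero_div]
  have hζ0 : ζ 0 = a - 1 := by simp [ζ]
  have hpS : p ∈ S := by
    refine ⟨⟨den_eq_of_num_eq_zero ha hp, ?_⟩, ?_⟩
    · change f p ∈ V
      rw [hfp]
      refine ⟨by simp [V₀], ?_⟩
      have : D 0 = 1 := by
        simp only [D, hζ0]; field_simp; ring
      change D 0 ∈ Complex.slitPlane
      rw [this]; exact Complex.one_mem_slitPlane
    · have : g p = 1 := by
        simp only [g, hfp, hζ0, hεp]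
        field_simp; exact hε
      change 0 < (g p).re
      rw [this]; exact one_pos
  let Z : ℂ → ℂ := fun u => (ζ u + ε * (a + 1) * (D u).sqrt) / 2
  have hZc : ContinuousOn Z V := by
    refine ContinuousOn.div_const ?_ _
    refine (hζ.mono Set.inter_subset_left).add (continuousOn_const.mul ?_)
    exact continuousOn_sqrt.comp (hDc.mono Set.inter_subset_left) fun u hu => hu.2
  have hZ2 : ∀ u, Z u ^ 2 - ζ u * Z u - a = 0 := by
    intro u
    have h1 : (a + 1 : ℂ) ^ 2 * (D u).sqrt ^ 2 = ζ u ^ 2 + 4 * a := by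
      rw [sqrt_sq]; simp only [D]; field_simp
    simp only [Z]
    linear_combination h1 / 4 + (a + 1 : ℂ) ^ 2 * (D u).sqrt ^ 2 / 4 * hε
  have hZ0 : ∀ u, Z u ≠ 0 := by
    intro u h
    have := hZ2 u
    rw [h] at this
    apply ha0; linear_combination -this
  have hden : ∀ u ∈ V₀, den a (Z u) = Z u * (2 * (a - 1)) / (1 - u ^ 2) := by
    intro u hu
    have hu' : (1 - u ^ 2 : ℂ) ≠ 0 := hu
    have h1 : ζ u * (1 - u ^ 2) = (a - 1) * (1 + u ^ 2) := div_mul_cancel₀ _ hu'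
    rw [eq_div_iff hu', den]
    linear_combination (1 - u ^ 2) * hZ2 u + Z u * h1
  have hnum : ∀ u ∈ V₀, num a (Z u) = u ^ 2 * den a (Z u) := by
    intro u hu
    have hu' : (1 - u ^ 2 : ℂ) ≠ 0 := hu
    have h1 : ζ u * (1 - u ^ 2) = (a - 1) * (1 + u ^ 2) := div_mul_cancel₀ _ hu'
    rw [num, den]
    linear_combination (1 - u ^ 2) * hZ2 u + Z u * h1
  have hden0 : ∀ u ∈ V₀, den a (Z u) ≠ 0 := by
    intro u hu
    rw [hden u hu]
    exact div_ne_zero (mul_ne_zero (hZ0 u) (mul_ne_zero two_ne_zero hb)) hu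
  obtain ⟨e, he, he'⟩ := exists_chart_of_inverse (S := S) (V := V) (f := f) (Z := Z)
    (Y := fun u => u * den a (Z u)) hS hV
    (hf.mono (Set.inter_subset_left.trans Set.inter_subset_left)) hZc
    (continuousOn_id.mul ((hZc.sub continuousOn_const).mul (hZc.add continuousOn_const)))
    (fun u hu => by
      change (u * den a (Z u)) ^ 2 = (Z u ^ 2 - 1) * (Z u ^ 2 - (a : ℂ) ^ 2)
      have : (Z u ^ 2 - 1) * (Z u ^ 2 - (a : ℂ) ^ 2) = num a (Z u) * den a (Z u) := by
        rw [num, den]; ring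
      rw [this, hnum u hu.1]; ring)
    (fun q hq => by
      have hq0 : den a (z q) ≠ 0 := hq.1.1
      have hqV : f q ∈ V := hq.1.2
      have hq1 : (1 - f q ^ 2 : ℂ) ≠ 0 := hqV.1
      have h1 : ζ (f q) * (1 - f q ^ 2) = (a - 1) * (1 + f q ^ 2) := div_mul_cancel₀ _ hq1
      have h2 : f q ^ 2 * den a (z q) = num a (z q) := by
        simp only [f]; rw [div_pow, y_sq]; field_simp
      have h3 : z q ^ 2 - ζ (f q) * z q - a = 0 := by
        rw [num, den] at h2
        have : (1 - f q ^ 2) * (z q ^ 2 - ζ (f q) * z q - a) = 0 := by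
          linear_combination -h2 - z q * h1
        exact (mul_eq_zero.1 this).resolve_left hq1
      have h4 : g q ^ 2 = D (f q) := by
        simp only [g, D]
        rw [div_pow, div_left_inj' (pow_ne_zero 2 hc)]
        linear_combination 4 * h3 + (2 * z q - ζ (f q)) ^ 2 * hε
      have h5 := eq_sqrt_of_sq_eq h4 hq.2
      have h6 : Z (f q) = z q := by
        simp only [Z]
        rw [← h5]
        simp only [g]
        field_simp
        linear_combination (2 * z q - ζ (f q)) * hε
      refine ⟨hqV, h6, ?_⟩
      rw [h6]
      exact div_mul_cancel₀ _ hq0)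
    (fun u hu => by
      have h0 := hden0 u hu.1
      have hfu : ∀ h, f ⟨(Z u, u * den a (Z u)), h⟩ = u := fun h =>
        mul_div_cancel_right₀ u h0
      refine ⟨⟨⟨h0, ?_⟩, ?_⟩, hfu _⟩
      · change f _ ∈ V
        rw [hfu]; exact hu
      · change 0 < ((2 * Z u - ζ (f _)) * ε / (a + 1)).re
        rw [hfu]
        have : (2 * Z u - ζ u) * ε / (a + 1) = (D u).sqrt := by
          simp only [Z]
          field_simp
          linear_combination (a + 1 : ℂ) * (D u).sqrt * hε
        rw [this]
        exact sqrt_re_pos hu.2) p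
  exact ⟨e, he ▸ hpS, fun q hq => by
    rw [he] at hq
    exact ⟨hq.1.1, he' q⟩⟩

theorem num_neg (u : ℂ) : num a (-u) = den a u := by rw [num, den]; ring

theorem den_neg (u : ℂ) : den a (-u) = num a u := by rw [num, den]; ring

/-- The holomorphic involution `(z, y) ↦ (-z, y)`, that is `(z, w) ↦ (-z, 1 / w)`. -/
def negZ (a : ℝ) : Curve a ≃ₜ Curve a where
  toFun p := ⟨(-z p, y p), by
    have h : y p ^ 2 = (z p ^ 2 - 1) * (z p ^ 2 - (a : ℂ) ^ 2) := p.2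
    change y p ^ 2 = ((-z p) ^ 2 - 1) * ((-z p) ^ 2 - (a : ℂ) ^ 2)
    rw [h]; ring⟩
  invFun p := ⟨(-z p, y p), by
    have h : y p ^ 2 = (z p ^ 2 - 1) * (z p ^ 2 - (a : ℂ) ^ 2) := p.2
    change y p ^ 2 = ((-z p) ^ 2 - 1) * ((-z p) ^ 2 - (a : ℂ) ^ 2)
    rw [h]; ring⟩
  left_inv p := ext (neg_neg _) rfl
  right_inv p := ext (neg_neg _) rfl
  continuous_toFun := (continuous_z.neg.prodMk continuous_y).subtype_mk _
  continuous_invFun := (continuous_z.neg.prodMk continuous_y).subtype_mk _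

theorem exists_chart (ha : 1 < a) (p : Curve a) :
    ∃ e : OpenPartialHomeomorph (Curve a) ℂ, p ∈ e.source ∧ ∀ q ∈ e.source, e q = coord p q := by
  by_cases hd : den a (z p) = 0
  -- The involution z ↦ -z exchanges `num` and `den`, so a pole of w becomes a zero and the chart w
  -- there pulls back to 1 / w.
  · obtain ⟨e, hpe, he⟩ := exists_chart_of_num_eq_zero ha (p := negZ a p)
      ((num_neg (z p)).trans hd)
    refine ⟨(negZ a).toOpenPartialHomeomorph.trans e, by simpa using hpe, fun q hq => ?_⟩
    obtain ⟨h1, h2⟩ := he (negZ a q) (by simpa using hq)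
    change den a (-z q) ≠ 0 at h1
    change e (negZ a q) = y q / den a (-z q) at h2
    rw [den_neg] at h1 h2
    change e (negZ a q) = _
    rw [h2, coord, if_pos hd]
    by_cases hy : y q = 0
    · have : den a (z q) = 0 := ((y_eq_zero_iff q).1 hy).resolve_left h1
      rw [hy, this]; simp
    · rw [div_eq_div_iff h1 hy, ← sq, y_sq, mul_comm]
  · by_cases hn : num a (z p) = 0
    · obtain ⟨e, hpe, he⟩ := exists_chart_of_num_eq_zero ha hn
      refine ⟨e, hpe, fun q hq => ?_⟩
      rw [(he q hq).2, coord, if_neg hd, if_pos hn]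
    · exact exists_chart_of_y_ne_zero (by rw [Ne, y_eq_zero_iff]; tauto)

end Curve

end GenusOneFace

/-! ### Uniqueness of null lifts. -/

namespace GenusOneFace

open Curve

variable {a : ℝ} {X : Type*} [TopologicalSpace X] {π : X → Curve a}

theorem exists_chart_of_isCoveringMap (ha : 1 < a) (hπ : IsCoveringMap π) (x : X) :
    ∃ e : OpenPartialHomeomorph X ℂ, x ∈ e.source ∧
      ∀ x' ∈ e.source, e x' = coord (π x) (π x') := by
  obtain ⟨e₁, h₁, he₁⟩ := hπ.isLocalHomeomorph x
  obtain ⟨e₂, h₂, he₂⟩ := exists_chart ha (π x)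
  refine ⟨e₁.trans e₂, ?_, fun x' hx' => ?_⟩
  · rw [OpenPartialHomeomorph.trans_source]
    exact ⟨h₁, by rw [Set.mem_preimage, ← he₁]; exact h₂⟩
  · rw [OpenPartialHomeomorph.trans_source] at hx'
    rw [OpenPartialHomeomorph.trans_apply, he₂ _ hx'.2, ← he₁]

theorem locallyPathConnectedSpace_of_isCoveringMap (ha : 1 < a) (hπ : IsCoveringMap π) :
    LocallyPathConnectedSpace X := by
  choose e he _ using exists_chart_of_isCoveringMap ha hπ
  let _ : ChartedSpace ℂ X :=
    { atlas := Set.range e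
      chartAt := e
      mem_chart_source := he
      chart_mem_atlas := fun x => ⟨x, rfl⟩ }
  exact ChartedSpace.locallyPathConnectedSpace ℂ X

theorem isNullLift_toM_iff (ha : 1 < a) {c : ℝ} {F : X → Matrix.SpecialLinearGroup (Fin 2) ℂ} :
    IsNullLift c (toM ∘ π) F ↔ ∀ x : X, ∃ g : ℂ → Matrix (Fin 2) (Fin 2) ℂ,
      (∀ i j, AnalyticAt ℂ (fun t => g t i j) (coord (π x) (π x))) ∧
      (∀ᶠ x' in 𝓝 x, (F x').1 = g (coord (π x) (π x'))) ∧
      (y (π x) ≠ 0 → ∀ i j, HasDerivAt (fun t => g t i j)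
        ((nullForm c (y (π x) / den a (z (π x))) * (F x).1) i j) (z (π x))) := by
  simp only [IsNullLift, Function.comp_apply, localCoord_toM ha, isUnbranched_toM ha, wCoord_toM,
    zCoord_toM]

theorem eventually_y_ne_zero (p : Curve a) : ∀ᶠ q in 𝓝 p, q ≠ p → y q ≠ 0 := by
  have hfin : {q : Curve a | y q = 0}.Finite := by
    refine Set.Finite.of_finite_image (f := z)
      (Set.Finite.subset (s := {1, -1, (a : ℂ), -(a : ℂ)}) (by simp) ?_) ?_
    · rintro _ ⟨q, hq, rfl⟩
      rcases (y_eq_zero_iff q).1 hq with h | h <;> rcases mul_eq_zero.1 h with h | h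
      · simp [eq_neg_of_add_eq_zero_left h]
      · simp [sub_eq_zero.1 h]
      · simp [sub_eq_zero.1 h]
      · simp [eq_neg_of_add_eq_zero_left h]
    · intro q hq q' hq' h
      exact ext h (hq.trans hq'.symm)
  have hcl : IsClosed ({q : Curve a | y q = 0} \ {p}) := (hfin.subset Set.sdiff_subset).isClosed
  filter_upwards [hcl.isOpen_compl.mem_nhds (by simp : p ∈ ({q : Curve a | y q = 0} \ {p})ᶜ)]
    with q hq hqp hy
  exact hq ⟨hy, hqp⟩

theorem eventually_eq_of_eventually_hasDerivAt_zero {f : ℂ → ℂ} {t₀ : ℂ}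
    (h : ∀ᶠ t in 𝓝 t₀, HasDerivAt f 0 t) : ∀ᶠ t in 𝓝 t₀, f t = f t₀ := by
  obtain ⟨r, hr, hball⟩ := Metric.eventually_nhds_iff_ball.1 h
  filter_upwards [Metric.ball_mem_nhds t₀ hr] with t ht
  exact Metric.isOpen_ball.is_const_of_deriv_eq_zero (convex_ball t₀ r).isPreconnected
    (fun s hs => (hball s hs).differentiableAt.differentiableWithinAt)
    (fun s hs => (hball s hs).deriv) ht (Metric.mem_ball_self hr)

variable {c : ℝ} {F F' : X → Matrix.SpecialLinearGroup (Fin 2) ℂ}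

/-- The definition gives the differential equation only at the centre of each germ. Nearby germs are
all expressed in the same coordinate z and represent the same F, so they agree with `g`, which
therefore solves the equation on a neighbourhood. -/
theorem eventually_hasDerivAt_of_isNullLift (ha : 1 < a) (hπ : IsCoveringMap π)
    (hF : IsNullLift c (toM ∘ π) F) {x : X} (hx : y (π x) ≠ 0)
    {e : OpenPartialHomeomorph X ℂ} (hxe : x ∈ e.source)
    (he : ∀ x' ∈ e.source, e x' = coord (π x) (π x'))
    {g : ℂ → Matrix (Fin 2) (Fin 2) ℂ}
    (hg : ∀ᶠ x' in 𝓝 x, (F x').1 = g (coord (π x) (π x'))) :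
    ∀ᶠ t in 𝓝 (e x), ∀ i j, HasDerivAt (fun t => g t i j)
      ((nullForm c (y (π (e.symm t)) / den a (z (π (e.symm t)))) * g t) i j) t := by
  rw [isNullLift_toM_iff ha] at hF
  have hsymm : Filter.Tendsto e.symm (𝓝 (e x)) (𝓝 x) := by
    have := e.continuousAt_symm (e.map_source hxe)
    rwa [ContinuousAt, e.left_inv hxe] at this
  have hy : ∀ᶠ x' in 𝓝 x, y (π x') ≠ 0 :=
    (continuous_y.comp hπ.continuous).continuousAt.eventually_ne hx
  filter_upwards [hsymm.eventually hy, hsymm.eventually hg.eventually_nhds,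
    e.open_target.mem_nhds (e.map_source hxe)] with t hty htg hte i j
  obtain ⟨k, -, hk, hk'⟩ := hF (e.symm t)
  have hz : ∀ s ∈ e.target, z (π (e.symm s)) = s := fun s hs => by
    rw [← coord_of_y_ne_zero hx, ← he _ (e.map_target hs), e.right_inv hs]
  have hd := hk' hty i j
  rw [hz t hte] at hd
  have hsymm' : Filter.Tendsto e.symm (𝓝 t) (𝓝 (e.symm t)) := e.continuousAt_symm hte
  have hgk : (fun s => k s i j) =ᶠ[𝓝 t] fun s => g s i j := by
    filter_upwards [hsymm'.eventually hk, hsymm'.eventually htg, e.open_target.mem_nhds hte]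
      with s hs1 hs2 hs3
    rw [coord_of_y_ne_zero hty, hz s hs3] at hs1
    rw [coord_of_y_ne_zero hx, hz s hs3] at hs2
    rw [← hs1, ← hs2]
  have hFt : (F (e.symm t)).1 = g t := by
    have := htg.self_of_nhds
    rwa [coord_of_y_ne_zero hx, hz t hte] at this
  rw [hFt] at hd
  rw [hz t hte]
  exact hd.congr_of_eventuallyEq hgk.symm

/-- For trace-free N one has adj(N g) = -adj(g) N in size two, so the two terms of the product rule
cancel. -/
theorem hasDerivAt_adjugate_mul {g k : ℂ → Matrix (Fin 2) (Fin 2) ℂ}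
    {N : Matrix (Fin 2) (Fin 2) ℂ} (hN : N.trace = 0) {t : ℂ}
    (hg : ∀ i j, HasDerivAt (fun t => g t i j) ((N * g t) i j) t)
    (hk : ∀ i j, HasDerivAt (fun t => k t i j) ((N * k t) i j) t) (i j : Fin 2) :
    HasDerivAt (fun t => ((g t).adjugate * k t) i j) 0 t := by
  have h11 : N 1 1 = -N 0 0 := by
    rw [Matrix.trace_fin_two] at hN; linear_combination hN
  simp only [Matrix.mul_apply, Fin.sum_univ_two] at hg hk
  revert i
  refine Fin.forall_fin_two.2 ⟨?_, ?_⟩ <;>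
    simp only [Matrix.adjugate_fin_two, Matrix.mul_apply, Fin.sum_univ_two, Matrix.of_apply,
      Matrix.cons_val_zero, Matrix.cons_val_one, Matrix.cons_val', Matrix.cons_val_fin_one]
  · refine (((hg 1 1).mul (hk 0 j)).add ((hg 0 1).neg.mul (hk 1 j))).congr_deriv ?_
    simp only [Pi.neg_apply, h11]; ring
  · refine (((hg 1 0).neg.mul (hk 0 j)).add ((hg 0 0).mul (hk 1 j))).congr_deriv ?_
    simp only [Pi.neg_apply, h11]; ring

theorem nullForm_trace (c : ℝ) (w : ℂ) : (nullForm c w).trace = 0 := by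
  simp [nullForm, Matrix.trace_fin_two]

theorem coe_inv_mul (A B : Matrix.SpecialLinearGroup (Fin 2) ℂ) :
    (A⁻¹ * B).1 = A.1.adjugate * B.1 := by
  rw [← Matrix.SpecialLinearGroup.coe_inv]; rfl

theorem eventually_inv_mul_eq_of_y_ne_zero (ha : 1 < a) (hπ : IsCoveringMap π)
    (hF : IsNullLift c (toM ∘ π) F) (hF' : IsNullLift c (toM ∘ π) F') {x : X}
    (hx : y (π x) ≠ 0) : ∀ᶠ x' in 𝓝 x, (F x')⁻¹ * F' x' = (F x)⁻¹ * F' x := by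
  obtain ⟨e, hxe, he⟩ := exists_chart_of_isCoveringMap ha hπ x
  obtain ⟨g, -, hg, -⟩ := (isNullLift_toM_iff ha).1 hF x
  obtain ⟨k, -, hk, -⟩ := (isNullLift_toM_iff ha).1 hF' x
  have h1 := eventually_hasDerivAt_of_isNullLift ha hπ hF hx hxe he hg
  have h2 := eventually_hasDerivAt_of_isNullLift ha hπ hF' hx hxe he hk
  have h3 : ∀ i j, ∀ᶠ t in 𝓝 (e x), ((g t).adjugate * k t) i j =
      ((g (e x)).adjugate * k (e x)) i j := fun i j =>
    eventually_eq_of_eventually_hasDerivAt_zero (by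
      filter_upwards [h1, h2] with t ht1 ht2
      exact hasDerivAt_adjugate_mul (nullForm_trace c _) ht1 ht2 i j)
  have h4 : ∀ᶠ t in 𝓝 (e x), (g t).adjugate * k t = (g (e x)).adjugate * k (e x) := by
    filter_upwards [Filter.eventually_all.2 fun i => Filter.eventually_all.2 (h3 i)] with t ht
    ext i j; exact ht i j
  have hgx := hg.self_of_nhds
  have hkx := hk.self_of_nhds
  filter_upwards [hg, hk, (e.continuousAt hxe).eventually h4, e.open_source.mem_nhds hxe]
    with x' h5 h6 h7 h8
  apply Subtype.ext
  rw [coe_inv_mul, coe_inv_mul, h5, h6, hgx, hkx, ← he _ h8, ← he _ hxe, h7]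

/-- At a branch point the equation is not available, but the branch points are isolated: the
derivative of the analytic matrix F⁻¹F' vanishes on a punctured neighbourhood, hence also at the
centre. -/
theorem eventually_inv_mul_eq (ha : 1 < a) (hπ : IsCoveringMap π)
    (hF : IsNullLift c (toM ∘ π) F) (hF' : IsNullLift c (toM ∘ π) F') (x : X) :
    ∀ᶠ x' in 𝓝 x, (F x')⁻¹ * F' x' = (F x)⁻¹ * F' x := by
  obtain ⟨e, hxe, he⟩ := exists_chart_of_isCoveringMap ha hπ x
  obtain ⟨g, hga, hg, -⟩ := (isNullLift_toM_iff ha).1 hF x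
  obtain ⟨k, hka, hk, -⟩ := (isNullLift_toM_iff ha).1 hF' x
  rw [← he x hxe] at hga hka
  have hsymm : Filter.Tendsto e.symm (𝓝 (e x)) (𝓝 x) := by
    have := e.continuousAt_symm (e.map_source hxe)
    rwa [ContinuousAt, e.left_inv hxe] at this
  have htarget := e.open_target.mem_nhds (e.map_source hxe)
  let D : ℂ → Matrix (Fin 2) (Fin 2) ℂ := fun t => (g t).adjugate * k t
  have hDa : ∀ i j, AnalyticAt ℂ (fun t => D t i j) (e x) := by
    refine fun i j => ?_
    revert i
    refine Fin.forall_fin_two.2 ⟨?_, ?_⟩ <;>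
      simp only [D, Matrix.adjugate_fin_two, Matrix.mul_apply, Fin.sum_univ_two, Matrix.of_apply,
        Matrix.cons_val_zero, Matrix.cons_val_one, Matrix.cons_val', Matrix.cons_val_fin_one]
    · exact ((hga 1 1).mul (hka 0 j)).add ((hga 0 1).neg.mul (hka 1 j))
    · exact ((hga 1 0).neg.mul (hka 0 j)).add ((hga 0 0).mul (hka 1 j))
  have hD : ∀ᶠ t in 𝓝 (e x), ((F (e.symm t))⁻¹ * F' (e.symm t)).1 = D t := by
    filter_upwards [hsymm.eventually hg, hsymm.eventually hk, htarget] with t h1 h2 h3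
    rw [coe_inv_mul, h1, h2, ← he _ (e.map_target h3), e.right_inv h3]
  have hderiv : ∀ᶠ t in 𝓝[≠] (e x), ∀ i j, HasDerivAt (fun t => D t i j) 0 t := by
    rw [eventually_nhdsWithin_iff]
    filter_upwards [hD.eventually_nhds, htarget, hsymm.eventually
      (hπ.continuous.continuousAt.eventually (eventually_y_ne_zero (π x)))] with t h1 h2 h3 h4 i j
    have hne : π (e.symm t) ≠ π x := fun h => h4 (by
      rw [Set.mem_singleton_iff, ← e.right_inv h2, he _ (e.map_target h2), he x hxe, h])
    have h5 := (e.continuousAt_symm h2).eventually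
      (eventually_inv_mul_eq_of_y_ne_zero ha hπ hF hF' (h3 hne))
    refine (hasDerivAt_const t (D t i j)).congr_of_eventuallyEq ?_
    filter_upwards [h1, h5] with s h6 h7
    rw [← h6, h7, h1.self_of_nhds]
  have hderiv' : ∀ i j, ∀ᶠ t in 𝓝 (e x), HasDerivAt (fun t => D t i j) 0 t := by
    intro i j
    have h1 : ∀ᶠ t in 𝓝 (e x), deriv (fun t => D t i j) t = 0 :=
      (hDa i j).deriv.frequently_zero_iff_eventually_zero.1
        (hderiv.mono fun t ht => (ht i j).deriv).frequently
    filter_upwards [h1, (hDa i j).eventually_analyticAt] with t h2 h3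
    rw [← h2]; exact h3.differentiableAt.hasDerivAt
  have hconst : ∀ᶠ t in 𝓝 (e x), D t = D (e x) := by
    filter_upwards [Filter.eventually_all.2 fun i => Filter.eventually_all.2 fun j =>
      eventually_eq_of_eventually_hasDerivAt_zero (hderiv' i j)] with t ht
    ext i j; exact ht i j
  have hDx := hD.self_of_nhds
  rw [e.left_inv hxe] at hDx
  filter_upwards [(e.continuousAt hxe).eventually (hD.and hconst), e.open_source.mem_nhds hxe]
    with x' h1 h2
  rw [e.left_inv h2] at h1
  exact Subtype.ext (by rw [h1.1, h1.2, hDx])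

/-- A null lift is determined by its value at one point, up to a constant right factor. -/
theorem eq_mul_of_isNullLift [PreconnectedSpace X] (ha : 1 < a) (hπ : IsCoveringMap π)
    (hF : IsNullLift c (toM ∘ π) F) (hF' : IsNullLift c (toM ∘ π) F') (x₀ x : X) :
    F' x = F x * ((F x₀)⁻¹ * F' x₀) := by
  have h : IsLocallyConstant fun x => (F x)⁻¹ * F' x :=
    (IsLocallyConstant.iff_eventually_eq _).2 (eventually_inv_mul_eq ha hπ hF hF')
  rw [← h.apply_eq_of_isPreconnected isPreconnected_univ (Set.mem_univ x) (Set.mem_univ x₀),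
    mul_inv_cancel_left]

theorem isNullLift_mul_right (ha : 1 < a) (hF : IsNullLift c (toM ∘ π) F)
    (C : Matrix.SpecialLinearGroup (Fin 2) ℂ) : IsNullLift c (toM ∘ π) fun x => F x * C := by
  rw [isNullLift_toM_iff ha] at hF ⊢
  intro x
  obtain ⟨g, hga, hg, hg'⟩ := hF x
  refine ⟨fun t => g t * C.1, fun i j => ?_, ?_, fun hx i j => ?_⟩
  · simp only [Matrix.mul_apply, Fin.sum_univ_two]
    exact ((hga i 0).mul analyticAt_const).add ((hga i 1).mul analyticAt_const)
  · filter_upwards [hg] with x' hx'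
    rw [Matrix.SpecialLinearGroup.coe_mul, hx']
  · rw [Matrix.SpecialLinearGroup.coe_mul, ← Matrix.mul_assoc, Matrix.mul_apply,
      Fin.sum_univ_two]
    simp only [Matrix.mul_apply (N := C.1), Fin.sum_univ_two]
    exact ((hg' hx i 0).mul_const _).add ((hg' hx i 1).mul_const _)

end GenusOneFace

/-! ### Symmetries of the curve acting on null lifts. -/

namespace GenusOneFace

open Curve

/-- A holomorphic or antiholomorphic symmetry `φ` of the curve, together with the automorphism
`A ↦ U · A^f · U` of `2 × 2` matrices (`f` is the identity or the complex conjugation) that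
carries the pulled back differential equation of null lifts to itself. -/
structure CurveSymmetry (a : ℝ) where
  /-- the map of the curve -/
  φ : Curve a → Curve a
  /-- the automorphism of the scalars -/
  f : ℂ →+* ℂ
  /-- the conjugating matrix -/
  U : Matrix (Fin 2) (Fin 2) ℂ
  /-- the sign in the transformation law of the local coordinates -/
  s : Curve a → ℂ
  continuous_φ : Continuous φ
  f_eq : f = RingHom.id ℂ ∨ f = starRingEnd ℂ
  U_mul : U * U = 1
  U_conjTranspose : Uᴴ = U
  s_eq : ∀ p, s p = 1 ∨ s p = -1
  y_ne_zero : ∀ p, y p ≠ 0 → y (φ p) ≠ 0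
  coord_eq : ∀ p q, coord (φ p) (φ q) = s p * f (coord p q)
  form_eq : ∀ (c : ℝ) p, y p ≠ 0 →
    s p • (U * (nullForm c (y (φ p) / den a (z (φ p)))).map f * U) =
      nullForm c (y p / den a (z p))

/-- Conjugating both the argument and the value of a holomorphic function leaves it holomorphic;
thus antiholomorphic symmetries also produce null lifts. -/
theorem hasDerivAt_ringHom_comp {f : ℂ →+* ℂ} (hf : f = RingHom.id ℂ ∨ f = starRingEnd ℂ) {s : ℂ}
    (hs : s = 1 ∨ s = -1) {g : ℂ → ℂ} {d u : ℂ} (hg : HasDerivAt g d (s * f u)) :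
    HasDerivAt (fun t => f (g (s * f t))) (s * f d) u := by
  have hs' : f s = s := by rcases hs with rfl | rfl <;> simp
  have hss : s * s = 1 := by rcases hs with rfl | rfl <;> norm_num
  rcases hf with rfl | rfl
  · simp only [RingHom.id_apply] at hg ⊢
    have := HasDerivAt.comp u hg ((hasDerivAt_id u).const_mul s)
    exact this.congr_deriv (by ring)
  · have h1 : HasDerivAt (fun t => g (s * t)) (d * (s * 1)) (conj u) :=
      HasDerivAt.comp (conj u) hg ((hasDerivAt_id (conj u)).const_mul s)
    have h2 := h1.conj_conj
    rw [Complex.conj_conj] at h2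
    refine h2.congr_deriv ?_
    rw [map_mul, mul_one, hs', mul_comm]

theorem continuous_ringHom {f : ℂ →+* ℂ} (hf : f = RingHom.id ℂ ∨ f = starRingEnd ℂ) :
    Continuous f := by
  rcases hf with rfl | rfl
  · exact continuous_id
  · exact Complex.continuous_conj

theorem analyticAt_ringHom_comp {f : ℂ →+* ℂ} (hf : f = RingHom.id ℂ ∨ f = starRingEnd ℂ) {s : ℂ}
    (hs : s = 1 ∨ s = -1) {g : ℂ → ℂ} {u : ℂ} (hg : AnalyticAt ℂ g (s * f u)) :
    AnalyticAt ℂ (fun t => f (g (s * f t))) u := by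
  rw [Complex.analyticAt_iff_eventually_differentiableAt] at hg ⊢
  have hc : Continuous fun t => s * f t := continuous_const.mul (continuous_ringHom hf)
  filter_upwards [hc.continuousAt.eventually hg] with t ht
  exact (hasDerivAt_ringHom_comp hf hs ht.hasDerivAt).differentiableAt

namespace CurveSymmetry

variable {a : ℝ} (S : CurveSymmetry a)

/-- The automorphism `A ↦ U · A^f · U`. -/
def act (A : Matrix (Fin 2) (Fin 2) ℂ) : Matrix (Fin 2) (Fin 2) ℂ := S.U * A.map S.f * S.U

theorem act_mul (A B : Matrix (Fin 2) (Fin 2) ℂ) : S.act (A * B) = S.act A * S.act B := by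
  have : S.act A * S.act B = S.U * A.map S.f * (S.U * S.U) * B.map S.f * S.U := by
    simp only [act, Matrix.mul_assoc]
  rw [this, S.U_mul, act, Matrix.map_mul]
  simp only [Matrix.mul_assoc, Matrix.one_mul]

theorem act_conjTranspose (A : Matrix (Fin 2) (Fin 2) ℂ) : S.act Aᴴ = (S.act A)ᴴ := by
  have h : Aᴴ.map S.f = (A.map S.f)ᴴ := by
    ext i j
    rcases S.f_eq with h | h <;> simp [h]
  rw [act, act, h, Matrix.conjTranspose_mul, Matrix.conjTranspose_mul, S.U_conjTranspose,
    Matrix.mul_assoc]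

theorem act_det (A : Matrix (Fin 2) (Fin 2) ℂ) : (S.act A).det = S.f A.det := by
  have h := congrArg Matrix.det S.U_mul
  rw [Matrix.det_mul, Matrix.det_one] at h
  have h2 : (A.map S.f).det = S.f A.det := by
    simp [Matrix.det_fin_two]
  rw [act, Matrix.det_mul, Matrix.det_mul, h2]
  linear_combination S.f A.det * h

/-- The automorphism of `SL(2, ℂ)`. -/
def actSL (A : Matrix.SpecialLinearGroup (Fin 2) ℂ) : Matrix.SpecialLinearGroup (Fin 2) ℂ :=
  ⟨S.act A.1, by rw [act_det, A.2, map_one]⟩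

theorem continuous_act : Continuous S.act := by
  unfold act
  exact (continuous_const.matrix_mul
    (continuous_id.matrix_map (continuous_ringHom S.f_eq))).matrix_mul continuous_const

variable {X : Type*} [TopologicalSpace X] {π : X → Curve a} {c : ℝ}

theorem isNullLift (ha : 1 < a) {F : X → Matrix.SpecialLinearGroup (Fin 2) ℂ}
    (hF : IsNullLift c (toM ∘ π) F) {h : X → X} (hc : Continuous h)
    (hh : ∀ x, π (h x) = S.φ (π x)) : IsNullLift c (toM ∘ π) fun x => S.actSL (F (h x)) := by
  rw [isNullLift_toM_iff ha] at hF ⊢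
  intro x
  obtain ⟨g, hga, hg, hg'⟩ := hF (h x)
  rw [hh, S.coord_eq] at hga
  have hs := S.s_eq (π x)
  refine ⟨fun t => S.act (g (S.s (π x) * S.f t)), fun i j => ?_, ?_, fun hx i j => ?_⟩
  · simp only [act, Matrix.mul_apply, Fin.sum_univ_two, Matrix.map_apply]
    have hk := fun i j => analyticAt_ringHom_comp S.f_eq hs (hga i j)
    exact ((((analyticAt_const.mul (hk 0 0)).add (analyticAt_const.mul (hk 1 0))).mul
      analyticAt_const).add (((analyticAt_const.mul (hk 0 1)).add
      (analyticAt_const.mul (hk 1 1))).mul analyticAt_const))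
  · filter_upwards [hc.continuousAt.eventually hg] with x' hx'
    change S.act (F (h x')).1 = _
    rw [hx', hh, hh, S.coord_eq]
  · have hy : y (π (h x)) ≠ 0 := by rw [hh]; exact S.y_ne_zero _ hx
    have hz : z (π (h x)) = S.s (π x) * S.f (z (π x)) := by
      rw [← coord_of_y_ne_zero hy (π (h x)), ← coord_of_y_ne_zero hx (π x), hh, S.coord_eq]
    have hd := hg' hy
    rw [hz] at hd
    have hk := fun i j => hasDerivAt_ringHom_comp S.f_eq hs (hd i j)
    -- The chain rule contributes the factor `s`; together with multiplicativity of `act`, the field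
    -- `form_eq` turns the transformed equation back into the original one.
    have hform : S.s (π x) • S.act (nullForm c (y (π (h x)) / den a (S.s (π x) * S.f (z (π x)))) *
        (F (h x)).1) = nullForm c (y (π x) / den a (z (π x))) * S.act (F (h x)).1 := by
      rw [act_mul, ← Matrix.smul_mul, ← hz, hh]
      congr 1
      exact S.form_eq c (π x) hx
    change HasDerivAt _ ((nullForm c (y (π x) / den a (z (π x))) * S.act (F (h x)).1) i j) _
    rw [← hform]
    simp only [act, Matrix.smul_apply, smul_eq_mul, Matrix.mul_apply (M := _ * _) (N := S.U),
      Matrix.mul_apply (M := S.U), Fin.sum_univ_two, Matrix.map_apply]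
    refine ((((hk 0 0).const_mul _).add ((hk 1 0).const_mul _)).mul_const _).add
      ((((hk 0 1).const_mul _).add ((hk 1 1).const_mul _)).mul_const _) |>.congr_deriv ?_
    ring

end CurveSymmetry

end GenusOneFace

/-! ### The four reflections (z, ±w), (z̄, ±w̄) and the symmetry (-z̄, 1/w̄). -/

namespace GenusOneFace

open Curve

/-- The matrix that exchanges the two coordinates. -/
def swapMatrix : Matrix (Fin 2) (Fin 2) ℂ := !![0, 1; 1, 0]

theorem e₃_mul_e₃ : e₃ * e₃ = 1 := by
  rw [e₃, Matrix.one_fin_two]; simp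

theorem swapMatrix_mul_swapMatrix : swapMatrix * swapMatrix = 1 := by
  rw [swapMatrix, Matrix.one_fin_two]; simp

theorem e₃_conjTranspose : e₃ᴴ = e₃ := by
  ext i j; fin_cases i <;> fin_cases j <;> simp [e₃]

theorem swapMatrix_conjTranspose : swapMatrixᴴ = swapMatrix := by
  ext i j; fin_cases i <;> fin_cases j <;> simp [swapMatrix]

theorem swapMatrix_mul_mul_swapMatrix (A : Matrix (Fin 2) (Fin 2) ℂ) :
    swapMatrix * A * swapMatrix = !![A 1 1, A 1 0; A 0 1, A 0 0] := by
  rw [Matrix.eta_fin_two A]; simp [swapMatrix]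

theorem e₃_mul_mul_e₃ (A : Matrix (Fin 2) (Fin 2) ℂ) :
    e₃ * A * e₃ = !![A 0 0, -A 0 1; -A 1 0, A 1 1] := by
  rw [Matrix.eta_fin_two A]; simp [e₃]

theorem nullForm_eq (c : ℝ) {w : ℂ} (hw : w ≠ 0) :
    nullForm c w = !![(c : ℂ), -(c * w); c / w, -c] := by
  ext i j
  fin_cases i <;> fin_cases j <;> simp [nullForm] <;> field_simp

variable {a : ℝ}

theorem y_div_den_ne_zero {p : Curve a} (h : y p ≠ 0) : y p / den a (z p) ≠ 0 := by
  rw [Ne, y_eq_zero_iff, not_or] at *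
  rw [div_eq_zero_iff, y_eq_zero_iff]
  tauto

/-- The scalar automorphism of a symmetry: the identity or the complex conjugation. -/
def scalarAut (m : Bool) : ℂ →+* ℂ := if m then starRingEnd ℂ else RingHom.id ℂ

theorem scalarAut_eq (m : Bool) :
    scalarAut m = RingHom.id ℂ ∨ scalarAut m = starRingEnd ℂ := by
  cases m
  · exact Or.inl rfl
  · exact Or.inr rfl

theorem scalarAut_ofReal (m : Bool) (r : ℝ) : scalarAut m r = r := by
  cases m
  · rfl
  · exact Complex.conj_ofReal r

theorem scalarAut_scalarAut (m : Bool) (u : ℂ) : scalarAut m (scalarAut m u) = u := by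
  cases m
  · rfl
  · exact Complex.conj_conj u

theorem scalarAut_den (m : Bool) (u : ℂ) : den a (scalarAut m u) = scalarAut m (den a u) := by
  simp only [den, map_mul, map_sub, map_add, map_one, scalarAut_ofReal]

theorem scalarAut_num (m : Bool) (u : ℂ) : num a (scalarAut m u) = scalarAut m (num a u) := by
  simp only [num, map_mul, map_sub, map_add, map_one, scalarAut_ofReal]

/-- The sign of a symmetry. -/
def boolSign (n : Bool) : ℂ := if n then -1 else 1

theorem boolSign_eq (n : Bool) : boolSign n = 1 ∨ boolSign n = -1 := by
  cases n
  · exact Or.inl rfl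
  · exact Or.inr rfl

theorem boolSign_sq (n : Bool) : boolSign n ^ 2 = 1 := by
  cases n <;> norm_num [boolSign]

theorem boolSign_ne_zero (n : Bool) : boolSign n ≠ 0 := by
  cases n <;> norm_num [boolSign]

open Classical in
/-- The four symmetries `(z, w) ↦ (z, w), (z̄, w̄), (z, -w), (z̄, -w̄)`. -/
def reflection (a : ℝ) (m n : Bool) : CurveSymmetry a where
  φ p := ⟨(scalarAut m (z p), boolSign n * scalarAut m (y p)), by
    have h : y p ^ 2 = (z p ^ 2 - 1) * (z p ^ 2 - (a : ℂ) ^ 2) := p.2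
    change (boolSign n * scalarAut m (y p)) ^ 2 =
      (scalarAut m (z p) ^ 2 - 1) * (scalarAut m (z p) ^ 2 - (a : ℂ) ^ 2)
    rw [mul_pow, boolSign_sq, one_mul, ← map_pow, h]
    simp only [map_mul, map_sub, map_pow, map_one, scalarAut_ofReal]⟩
  f := scalarAut m
  U := if n then e₃ else 1
  -- The sign of w is seen only at the branch points, where the coordinate is w or 1 / w.
  s p := if y p = 0 then boolSign n else 1
  continuous_φ := (((continuous_ringHom (scalarAut_eq m)).comp continuous_z).prodMk
    (continuous_const.mul
      ((continuous_ringHom (scalarAut_eq m)).comp continuous_y))).subtype_mk _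
  f_eq := scalarAut_eq m
  U_mul := by cases n <;> simp [e₃_mul_e₃]
  U_conjTranspose := by cases n <;> simp [e₃_conjTranspose]
  s_eq p := by
    split_ifs
    · exact boolSign_eq n
    · exact Or.inl rfl
  y_ne_zero p hp := mul_ne_zero (boolSign_ne_zero n) ((map_ne_zero (scalarAut m)).2 hp)
  coord_eq p q := by
    simp only [coord]
    change (if den a (scalarAut m (z p)) = 0 then
      den a (scalarAut m (z q)) / (boolSign n * scalarAut m (y q))
      else if num a (scalarAut m (z p)) = 0 then
      boolSign n * scalarAut m (y q) / den a (scalarAut m (z q)) else scalarAut m (z q)) = _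
    simp only [scalarAut_den, scalarAut_num, map_eq_zero]
    by_cases h1 : den a (z p) = 0
    · rw [if_pos h1, if_pos h1, if_pos ((y_eq_zero_iff p).2 (Or.inr h1)), map_div₀]
      cases n
      · simp [boolSign]
      · simp [boolSign, div_neg]
    · rw [if_neg h1, if_neg h1]
      by_cases h2 : num a (z p) = 0
      · rw [if_pos h2, if_pos h2, if_pos ((y_eq_zero_iff p).2 (Or.inl h2)), map_div₀, mul_div_assoc]
      · rw [if_neg h2, if_neg h2, if_neg (by rw [y_eq_zero_iff]; tauto), one_mul]
  form_eq c p hp := by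
    have hw := y_div_den_ne_zero hp
    set w := y p / den a (z p) with hwdef
    have hw' : boolSign n * scalarAut m (y p) / den a (scalarAut m (z p)) =
        boolSign n * scalarAut m w := by
      rw [scalarAut_den, hwdef, map_div₀, mul_div_assoc]
    change (if y p = 0 then boolSign n else 1) • (_ * (nullForm c
      (boolSign n * scalarAut m (y p) / den a (scalarAut m (z p)))).map (scalarAut m) * _) = _
    rw [if_neg hp, one_smul, hw', nullForm_eq c hw, nullForm_eq c
      (mul_ne_zero (boolSign_ne_zero n) ((map_ne_zero (scalarAut m)).2 hw))]
    have hs : scalarAut m (boolSign n) = boolSign n := by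
      cases n <;> simp [boolSign]
    have hmap : (!![(c : ℂ), -(c * (boolSign n * scalarAut m w));
        c / (boolSign n * scalarAut m w), -c]).map (scalarAut m) =
        !![(c : ℂ), -(c * (boolSign n * w)); c / (boolSign n * w), -c] := by
      ext i j
      fin_cases i <;> fin_cases j <;>
        simp [scalarAut_ofReal, scalarAut_scalarAut, hs]
    rw [hmap]
    cases n
    · simp [boolSign]
    · ext i j
      fin_cases i <;> fin_cases j <;> simp [boolSign, e₃, div_neg]

open Classical in
/-- The symmetry `(z, w) ↦ (-z̄, 1 / w̄)`. -/
def imaginaryReflection (a : ℝ) (ha : 1 < a) : CurveSymmetry a where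
  φ p := ⟨(-conj (z p), conj (y p)), by
    have h : y p ^ 2 = (z p ^ 2 - 1) * (z p ^ 2 - (a : ℂ) ^ 2) := p.2
    change (conj (y p)) ^ 2 = ((-conj (z p)) ^ 2 - 1) * ((-conj (z p)) ^ 2 - (a : ℂ) ^ 2)
    rw [← map_pow, h]
    simp only [map_mul, map_sub, map_pow, map_one, Complex.conj_ofReal]
    ring⟩
  f := starRingEnd ℂ
  U := swapMatrix
  -- At branch points the coordinates w and 1 / w are exchanged without a sign; elsewhere z ↦ -z̄
  -- contributes -1.
  s p := if y p = 0 then 1 else -1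
  continuous_φ := ((Complex.continuous_conj.comp continuous_z).neg.prodMk
    (Complex.continuous_conj.comp continuous_y)).subtype_mk _
  f_eq := Or.inr rfl
  U_mul := swapMatrix_mul_swapMatrix
  U_conjTranspose := swapMatrix_conjTranspose
  s_eq p := by split_ifs <;> simp
  y_ne_zero p hp := (map_ne_zero (starRingEnd ℂ)).2 hp
  coord_eq p q := by
    have hd : ∀ u : ℂ, den a (conj u) = conj (den a u) := scalarAut_den true
    have hn : ∀ u : ℂ, num a (conj u) = conj (num a u) := scalarAut_num true
    have hyq : y q / num a (z q) = den a (z q) / y q := by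
      by_cases h : y q = 0
      · rw [h, zero_div, div_zero]
      · have h' := h
        rw [y_eq_zero_iff, not_or] at h'
        rw [div_eq_div_iff h'.1 h, ← sq, y_sq, mul_comm]
    simp only [coord]
    change (if den a (-conj (z p)) = 0 then den a (-conj (z q)) / conj (y q)
      else if num a (-conj (z p)) = 0 then conj (y q) / den a (-conj (z q))
      else -conj (z q)) = _
    simp only [den_neg, num_neg, hd, hn, map_eq_zero, ← map_div₀, hyq]
    by_cases h1 : den a (z p) = 0
    · rw [if_neg (num_ne_of_den_eq_zero ha h1), if_pos h1, if_pos h1,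
        if_pos ((y_eq_zero_iff p).2 (Or.inr h1)), one_mul]
    · rw [if_neg h1, if_neg h1]
      by_cases h2 : num a (z p) = 0
      · rw [if_pos h2, if_pos h2, if_pos ((y_eq_zero_iff p).2 (Or.inl h2)), one_mul,
          ← inv_div, hyq, inv_div]
      · rw [if_neg h2, if_neg h2, if_neg (by rw [y_eq_zero_iff]; tauto), neg_one_mul]
  form_eq c p hp := by
    have hw := y_div_den_ne_zero hp
    have hn : ∀ u : ℂ, num a (conj u) = conj (num a u) := scalarAut_num true
    have hw' : conj (y p) / den a (-conj (z p)) = (conj (y p / den a (z p)))⁻¹ := by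
      have h' := hp
      rw [Ne, y_eq_zero_iff, not_or] at h'
      rw [den_neg, hn, ← map_div₀, ← map_inv₀, inv_div]
      congr 1
      rw [div_eq_div_iff h'.1 hp, ← sq, y_sq, mul_comm]
    change (if y p = 0 then (1 : ℂ) else -1) • (swapMatrix * (nullForm c
      (conj (y p) / den a (-conj (z p)))).map (starRingEnd ℂ) * swapMatrix) = _
    rw [if_neg hp, hw', nullForm_eq c hw,
      nullForm_eq c (inv_ne_zero ((map_ne_zero (starRingEnd ℂ)).2 hw))]
    rw [swapMatrix_mul_mul_swapMatrix]
    ext i j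
    fin_cases i <;> fin_cases j <;> simp [div_eq_mul_inv]

end GenusOneFace

/-! ### The Hermitian matrix E m E* and the SU(1,1) condition as descent. -/

namespace GenusOneFace

open Curve

variable {a : ℝ} {X : Type*} [TopologicalSpace X] {π : X → Curve a} {c : ℝ}
  {E F : X → Matrix.SpecialLinearGroup (Fin 2) ℂ}

theorem isCoveringMap_toM_comp (ha : 1 < a) (hπ : IsCoveringMap π) :
    IsCoveringMap (toM ∘ π) := hπ.homeomorph_comp (homeo ha)

theorem exists_lift [SimplyConnectedSpace X] (ha : 1 < a) (hπ : IsCoveringMap π)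
    {φ : Curve a → Curve a} (hφ : Continuous φ) {x x' : X} (hx : π x' = φ (π x)) :
    ∃ h : X → X, Continuous h ∧ (∀ x, π (h x) = φ (π x)) ∧ h x = x' := by
  have := locallyPathConnectedSpace_of_isCoveringMap ha hπ
  obtain ⟨h, ⟨h1, h2⟩, -⟩ := hπ.existsUnique_continuousMap_lifts
    ⟨fun x => φ (π x), hφ.comp hπ.continuous⟩ x x' hx
  exact ⟨h, h.continuous, congrFun h2, h1⟩

theorem exists_deck [SimplyConnectedSpace X] (ha : 1 < a) (hπ : IsCoveringMap π)
    {x x' : X} (hx : π x' = π x) : ∃ τ : X ≃ₜ X, (∀ x, π (τ x) = π x) ∧ τ x = x' := by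
  obtain ⟨h, hc, hh, hx1⟩ := exists_lift ha hπ continuous_id hx
  obtain ⟨k, kc, hk, hx2⟩ := exists_lift ha hπ continuous_id hx.symm
  simp only [id] at hh hk
  have h1 : k ∘ h = id := hπ.eq_of_comp_eq (kc.comp hc) continuous_id
    (funext fun x => by simp [hh, hk]) x (by simp [hx1, hx2])
  have h2 : h ∘ k = id := hπ.eq_of_comp_eq (hc.comp kc) continuous_id
    (funext fun x => by simp [hh, hk]) x' (by simp [hx1, hx2])
  exact ⟨⟨⟨h, k, congrFun h1, congrFun h2⟩, hc, kc⟩, hh, hx1⟩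

/-- The matrix function `E m E*`. -/
def hermitian (E : X → Matrix.SpecialLinearGroup (Fin 2) ℂ) (m : Matrix (Fin 2) (Fin 2) ℂ)
    (x : X) : Matrix (Fin 2) (Fin 2) ℂ :=
  (E x).1 * m * (E x).1ᴴ

theorem coe_inv_mul_coe (A : Matrix.SpecialLinearGroup (Fin 2) ℂ) : (A⁻¹).1 * A.1 = 1 := by
  rw [← Matrix.SpecialLinearGroup.coe_mul, inv_mul_cancel]; rfl

theorem mul_mul_conjTranspose_injective (A : Matrix.SpecialLinearGroup (Fin 2) ℂ) :
    Function.Injective fun m : Matrix (Fin 2) (Fin 2) ℂ => A.1 * m * A.1ᴴ := by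
  have key : ∀ m : Matrix (Fin 2) (Fin 2) ℂ, (A⁻¹).1 * (A.1 * m * A.1ᴴ) * (A⁻¹).1ᴴ = m := by
    intro m
    have : (A⁻¹).1 * (A.1 * m * A.1ᴴ) * (A⁻¹).1ᴴ =
        ((A⁻¹).1 * A.1) * m * ((A⁻¹).1 * A.1)ᴴ := by
      rw [Matrix.conjTranspose_mul]; simp only [Matrix.mul_assoc]
    rw [this, coe_inv_mul_coe, Matrix.conjTranspose_one, Matrix.one_mul, Matrix.mul_one]
  intro m m' h
  rw [← key m, ← key m']
  exact congrArg (fun N => (A⁻¹).1 * N * (A⁻¹).1ᴴ) h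

theorem hermitian_injective {Y : Type*} {E : Y → Matrix.SpecialLinearGroup (Fin 2) ℂ}
    {m m' : Matrix (Fin 2) (Fin 2) ℂ} {x : Y}
    (h : hermitian E m x = hermitian E m' x) : m = m' :=
  mul_mul_conjTranspose_injective (E x) h

namespace CurveSymmetry

variable (S : CurveSymmetry a)

/-- The transformed lift is again a null lift, so it equals E C with C constant, and k = C · act(m)
· C*. -/
theorem exists_act_hermitian_eq [PreconnectedSpace X] [Nonempty X] (ha : 1 < a)
    (hπ : IsCoveringMap π) (hE : IsNullLift c (toM ∘ π) E) {h : X → X} (hc : Continuous h)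
    (hh : ∀ x, π (h x) = S.φ (π x)) (m : Matrix (Fin 2) (Fin 2) ℂ) :
    ∃ k, ∀ x, S.act (hermitian E m (h x)) = hermitian E k x := by
  obtain ⟨x₀⟩ := ‹Nonempty X›
  have hS := S.isNullLift ha hE hc hh
  set C := (E x₀)⁻¹ * S.actSL (E (h x₀)) with hC
  refine ⟨C.1 * S.act m * C.1ᴴ, fun x => ?_⟩
  have h1 : S.act (E (h x)).1 = (E x).1 * C.1 :=
    congrArg Subtype.val (eq_mul_of_isNullLift ha hπ hE hS x₀ x)
  rw [hermitian, act_mul, act_mul, act_conjTranspose, h1, hermitian, Matrix.conjTranspose_mul]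
  simp only [Matrix.mul_assoc]

/-- As E is invertible, equality at the single point x₁ already forces k = m. -/
theorem act_hermitian_eq [PreconnectedSpace X] (ha : 1 < a)
    (hπ : IsCoveringMap π) (hE : IsNullLift c (toM ∘ π) E) {h : X → X} (hc : Continuous h)
    (hh : ∀ x, π (h x) = S.φ (π x)) {m : Matrix (Fin 2) (Fin 2) ℂ} {x₁ : X}
    (hx₁ : S.act (hermitian E m (h x₁)) = hermitian E m x₁) (x : X) :
    S.act (hermitian E m (h x)) = hermitian E m x := by
  have : Nonempty X := ⟨x⟩
  obtain ⟨k, hk⟩ := S.exists_act_hermitian_eq ha hπ hE hc hh m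
  rw [hk x, ← hermitian_injective ((hk x₁).symm.trans hx₁).symm]

end CurveSymmetry

theorem reflection_act (m n : Bool) (A : Matrix (Fin 2) (Fin 2) ℂ) :
    (reflection a m n).act A =
      !![scalarAut m (A 0 0), boolSign n * scalarAut m (A 0 1);
        boolSign n * scalarAut m (A 1 0), scalarAut m (A 1 1)] := by
  change (if n then e₃ else 1) * A.map (scalarAut m) * (if n then e₃ else 1) = _
  cases n
  · ext i j
    fin_cases i <;> fin_cases j <;> simp [boolSign]
  · simp [e₃_mul_mul_e₃, boolSign]

theorem imaginaryReflection_act (ha : 1 < a) (A : Matrix (Fin 2) (Fin 2) ℂ) :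
    (imaginaryReflection a ha).act A =
      !![conj (A 1 1), conj (A 1 0); conj (A 0 1), conj (A 0 0)] := by
  change swapMatrix * A.map (starRingEnd ℂ) * swapMatrix = _
  rw [swapMatrix_mul_mul_swapMatrix]; rfl

theorem isNullLift_comp_deck (ha : 1 < a) (hF : IsNullLift c (toM ∘ π) F) {τ : X → X}
    (hτ : Continuous τ) (hπτ : ∀ x, π (τ x) = π x) :
    IsNullLift c (toM ∘ π) fun x => F (τ x) := by
  have h := (reflection a false false).isNullLift ha hF hτ fun x => by
    rw [hπτ]; exact ext rfl (one_mul _).symm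
  convert h using 2 with x
  refine Subtype.ext (Eq.symm ((reflection_act false false _).trans ?_))
  ext i j
  fin_cases i <;> fin_cases j <;> simp [scalarAut, boolSign]

theorem mem_SU11_iff (Φ : Matrix.SpecialLinearGroup (Fin 2) ℂ) :
    Φ ∈ SU11 ↔ Φ.1 * e₃ * Φ.1ᴴ = e₃ := by
  have key : ∀ A B : Matrix (Fin 2) (Fin 2) ℂ, A * e₃ * B = e₃ → B * e₃ * A = e₃ := by
    intro A B h
    have h1 : (A * e₃) * (B * e₃) = 1 := by
      rw [← Matrix.mul_assoc, h, e₃_mul_e₃]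
    have h2 := mul_eq_one_comm.1 h1
    calc B * e₃ * A = B * e₃ * (A * e₃) * e₃ := by
          rw [Matrix.mul_assoc (B * e₃), Matrix.mul_assoc A, e₃_mul_e₃, Matrix.mul_one]
      _ = e₃ := by rw [h2, Matrix.one_mul]
  exact ⟨key _ _, key _ _⟩

/-- Any two points of a fibre are related by a deck transformation τ, and F ∘ τ = F Φ turns F e₃ F*
into F (Φ e₃ Φ*) F*. The two agree precisely when Φ e₃ Φ* = e₃, which is membership in SU(1,1). -/
theorem satisfiesSU11_iff [SimplyConnectedSpace X] (ha : 1 < a) (hπ : IsCoveringMap π)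
    (hF : IsNullLift c (toM ∘ π) F) (x₀ : X) :
    SatisfiesSU11 (toM ∘ π) x₀ F ↔
      ∀ x x', π x = π x' → hermitian F e₃ x = hermitian F e₃ x' := by
  have hϖ := isCoveringMap_toM_comp ha hπ
  constructor
  · intro h x x' hxx'
    obtain ⟨τ, hτ, hτx⟩ := exists_deck ha hπ hxx'.symm
    obtain ⟨Γ⟩ := PathConnectedSpace.joined x₀ (τ x₀)
    have hend : (toM ∘ π) x₀ = (toM ∘ π) (τ x₀) := congrArg toM (hτ x₀).symm
    obtain ⟨Φ, hΦ, τ', ⟨hτ', Γ', hΓ'⟩, hFτ⟩ := h ((Γ.map hϖ.continuous).cast rfl hend)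
    -- The transformation supplied with the monodromy and the chosen one agree at x₀ by uniqueness
    -- of path lifting, hence everywhere.
    have h1 : (Γ' : I → X) = Γ := hϖ.eq_of_comp_eq Γ'.continuous Γ.continuous
      (funext fun t => hΓ' t) 0 (by rw [Γ'.source, Γ.source])
    have h2 : τ' x₀ = τ x₀ := by
      rw [← Γ'.target, ← Γ.target, h1]
    have h3 : (τ' : X → X) = τ := hϖ.eq_of_comp_eq τ'.continuous τ.continuous
      (funext fun x => (hτ' x).trans (congrArg toM (hτ x).symm)) x₀ h2
    rw [← hτx, ← h3, hermitian, hermitian, hFτ]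
    have : (F x * Φ).1 * e₃ * (F x * Φ).1ᴴ = (F x).1 * (Φ.1 * e₃ * Φ.1ᴴ) * (F x).1ᴴ := by
      rw [Matrix.SpecialLinearGroup.coe_mul, Matrix.conjTranspose_mul]
      simp only [Matrix.mul_assoc]
    rw [this, (mem_SU11_iff Φ).1 hΦ]
  · intro h γ
    obtain ⟨Γ, hΓ, hΓ0⟩ := hϖ.exists_path_lifts (γ : C(I, M a)) x₀ γ.source
    have hend : π (Γ 1) = π x₀ := toM_injective ((congrFun hΓ 1).trans γ.target)
    obtain ⟨τ, hτ, hτx⟩ := exists_deck ha hπ hend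
    have hτF := eq_mul_of_isNullLift ha hπ hF (isNullLift_comp_deck ha hF τ.continuous hτ) x₀
    refine ⟨(F x₀)⁻¹ * F (τ x₀), ?_, τ, ⟨fun x => congrArg toM (hτ x),
      ⟨Γ, hΓ0, hτx.symm⟩, fun t => congrFun hΓ t⟩, hτF⟩
    rw [mem_SU11_iff]
    apply mul_mul_conjTranspose_injective (F x₀)
    have h1 := h (τ x₀) x₀ (hτ x₀)
    rw [hermitian, hermitian, hτF x₀, Matrix.SpecialLinearGroup.coe_mul (F x₀),
      Matrix.conjTranspose_mul] at h1
    simp only [Matrix.mul_assoc] at h1 ⊢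
    exact h1

end GenusOneFace

/-! ### Algebra of the matrices E m E* and the expressions f₁, f₂. -/

namespace GenusOneFace

/-- The real symmetric matrix with diagonal entries `p` and off-diagonal entries `q`. -/
def symmMatrix (p q : ℝ) : Matrix (Fin 2) (Fin 2) ℂ := !![(p : ℂ), q; q, p]

theorem initialP_mul_e₃ {ε : ℝ} (hε : ε = 1 ∨ ε = -1) (α β : ℂ) :
    initialP ε α β * e₃ * (initialP ε α β)ᴴ =
      symmMatrix (‖α‖ ^ 2 - ‖β‖ ^ 2) (‖α‖ ^ 2 + ‖β‖ ^ 2) := by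
  have hα := Complex.mul_conj' α
  have hβ := Complex.mul_conj' β
  ext i j
  rcases hε with rfl | rfl <;> fin_cases i <;> fin_cases j <;>
    simp [initialP, e₃, symmMatrix, Matrix.mul_apply, Fin.sum_univ_two, ← hα, ← hβ] <;> ring

theorem mul_symmMatrix_mul (E : Matrix (Fin 2) (Fin 2) ℂ) (p q : ℝ) (i j : Fin 2) :
    (E * symmMatrix p q * Eᴴ) i j = (E i 0 * p + E i 1 * q) * conj (E j 0) +
      (E i 0 * q + E i 1 * p) * conj (E j 1) := by
  simp [symmMatrix, Matrix.mul_apply, Fin.sum_univ_two]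

theorem f₁_eq_iff {E : Matrix (Fin 2) (Fin 2) ℂ} {p q : ℝ} (hp : p ≠ 0) (hden : den₁ E ≠ 0) :
    f₁ E = q / p ↔
      (E * symmMatrix p q * Eᴴ) 0 1 + (E * symmMatrix p q * Eᴴ) 1 0 = 0 := by
  have hp' : (p : ℂ) ≠ 0 := Complex.ofReal_ne_zero.2 hp
  rw [f₁, ← neg_div, div_eq_div_iff hden hp', mul_symmMatrix_mul, mul_symmMatrix_mul, den₁]
  constructor <;> intro h <;> linear_combination -h

theorem f₂_eq_iff {E : Matrix (Fin 2) (Fin 2) ℂ} {p q : ℝ} (hp : p ≠ 0) (hden : den₂ E ≠ 0) :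
    f₂ E = q / p ↔
      (E * symmMatrix p q * Eᴴ) 0 1 = (E * symmMatrix p q * Eᴴ) 1 0 := by
  have hp' : (p : ℂ) ≠ 0 := Complex.ofReal_ne_zero.2 hp
  rw [f₂, ← neg_div, div_eq_div_iff hden hp', mul_symmMatrix_mul, mul_symmMatrix_mul, den₂]
  constructor <;> intro h <;> linear_combination h

/-- At p = 0 the sum is q · `den₁ E` with q² = 1, which cannot vanish. -/
theorem ne_zero_of_sum_eq_zero {E : Matrix (Fin 2) (Fin 2) ℂ} {p q : ℝ} (hpq : q ^ 2 - p ^ 2 = 1)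
    (hden : den₁ E ≠ 0)
    (h : (E * symmMatrix p q * Eᴴ) 0 1 + (E * symmMatrix p q * Eᴴ) 1 0 = 0) : p ≠ 0 := by
  rintro rfl
  rw [mul_symmMatrix_mul, mul_symmMatrix_mul] at h
  simp only [Complex.ofReal_zero] at h
  have h1 : (q : ℂ) * den₁ E = 0 := by rw [den₁]; linear_combination h
  rcases mul_eq_zero.1 h1 with h1 | h1
  · rw [Complex.ofReal_eq_zero] at h1
    subst h1; norm_num at hpq
  · exact hden h1

theorem one_lt_norm_div {p q : ℝ} (hp : p ≠ 0) (hpq : q ^ 2 - p ^ 2 = 1) :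
    1 < ‖(q / p : ℂ)‖ := by
  rw [norm_div, Complex.norm_real, Complex.norm_real, Real.norm_eq_abs, Real.norm_eq_abs,
    one_lt_div (abs_pos.2 hp), ← sq_lt_sq]
  linarith

/-- The difference n of the two symmetric matrices satisfies E n E* = s · J with J the exchange
matrix, so n = s E⁻¹ J (E*)⁻¹. The diagonal entries of n are equal, while those on the right differ,
up to sign, by 2s (Re(ĀC) - Re(B̄D)); hence s = 0 and n = 0. -/
theorem eq_of_mul_symmMatrix_mul {E : Matrix (Fin 2) (Fin 2) ℂ} (hE : E.det = 1)
    (hne : (conj (E 0 0) * E 1 0).re ≠ (conj (E 0 1) * E 1 1).re) {p q p' q' : ℝ}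
    (h00 : (E * symmMatrix p q * Eᴴ) 0 0 = (E * symmMatrix p' q' * Eᴴ) 0 0)
    (h11 : (E * symmMatrix p q * Eᴴ) 1 1 = (E * symmMatrix p' q' * Eᴴ) 1 1)
    (h01 : (E * symmMatrix p q * Eᴴ) 0 1 - (E * symmMatrix p' q' * Eᴴ) 0 1 =
      (E * symmMatrix p q * Eᴴ) 1 0 - (E * symmMatrix p' q' * Eᴴ) 1 0) :
    p = p' ∧ q = q' := by
  simp only [mul_symmMatrix_mul] at h00 h11 h01
  rw [Matrix.det_fin_two] at hE
  have hE' := congrArg (starRingEnd ℂ) hE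
  simp only [map_sub, map_mul, map_one] at hE'
  have hre : ∀ u v : ℂ, u + conj u = v + conj v → u.re = v.re := by
    intro u v h
    rw [Complex.add_conj, Complex.add_conj] at h
    have := Complex.ofReal_injective h
    linarith
  have hne' : conj (E 0 0) * E 1 0 + E 0 0 * conj (E 1 0) ≠
      conj (E 0 1) * E 1 1 + E 0 1 * conj (E 1 1) := by
    intro h
    apply hne
    apply hre
    simpa only [map_mul, Complex.conj_conj] using h
  generalize E 0 0 = A at *
  generalize E 0 1 = B at *
  generalize E 1 0 = C at *
  generalize E 1 1 = D at *
  generalize conj A = A' at *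
  generalize conj B = B' at *
  generalize conj C = C' at *
  generalize conj D = D' at *
  obtain ⟨x, hx⟩ : ∃ x : ℂ, x = p - p' := ⟨_, rfl⟩
  obtain ⟨w, hw⟩ : ∃ w : ℂ, w = q - q' := ⟨_, rfl⟩
  obtain ⟨s, hs⟩ : ∃ s : ℂ, s = (A * x + B * w) * C' + (A * w + B * x) * D' := ⟨_, rfl⟩
  have e00 : (A * x + B * w) * A' + (A * w + B * x) * B' = 0 := by
    rw [hx, hw]; linear_combination h00
  have e11 : (C * x + D * w) * C' + (C * w + D * x) * D' = 0 := by
    rw [hx, hw]; linear_combination h11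
  have e10 : (C * x + D * w) * A' + (C * w + D * x) * B' = s := by
    rw [hs, hx, hw]; linear_combination -h01
  -- The relations `i1` to `i4` are the entries of E n = s J (E*)⁻¹.
  have i1 : A * x + B * w = -s * B' := by
    linear_combination -(A * x + B * w) * hE' + D' * e00 + B' * hs
  have i2 : A * w + B * x = s * A' := by
    linear_combination -(A * w + B * x) * hE' - C' * e00 - A' * hs
  have i3 : C * x + D * w = s * D' := by
    linear_combination -(C * x + D * w) * hE' - B' * e11 + D' * e10
  have i4 : C * w + D * x = -s * C' := by
    linear_combination -(C * w + D * x) * hE' + A' * e11 - C' * e10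
  have hs0 : s = 0 := by
    have : s * ((A' * C + A * C') - (B' * D + B * D')) = 0 := by
      linear_combination -C * i2 + A * i4 - D * i1 + B * i3
    exact (mul_eq_zero.1 this).resolve_right (sub_ne_zero.2 hne')
  rw [hs0] at i1 i2 i3 i4
  have hx0 : x = 0 := by linear_combination D * i1 - B * i3 - x * hE
  have hw0 : w = 0 := by linear_combination A * i3 - C * i1 - w * hE
  rw [hx0] at hx
  rw [hw0] at hw
  constructor
  · apply Complex.ofReal_injective; linear_combination -hx
  · apply Complex.ofReal_injective; linear_combination -hw

theorem norm_mul_norm_eq {ε : ℝ} (hε : ε = 1 ∨ ε = -1) {α β : ℂ} (h : α * β = -ε / 2) :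
    ‖α‖ * ‖β‖ = 1 / 2 := by
  rw [← norm_mul, h]
  rcases hε with rfl | rfl <;> simp

/-- Multiply numerator and denominator by 4|β|² and use 4|α|²|β|² = 1. -/
theorem div_eq_of_norm_mul_norm_eq {α β : ℂ} (h : ‖α‖ * ‖β‖ = 1 / 2) :
    (((‖α‖ ^ 2 + ‖β‖ ^ 2 : ℝ) : ℂ)) / ((‖α‖ ^ 2 - ‖β‖ ^ 2 : ℝ) : ℂ) =
      (1 + 4 * (‖β‖ : ℂ) ^ 4) / (1 - 4 * (‖β‖ : ℂ) ^ 4) := by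
  have hβ : ‖β‖ ≠ 0 := by rintro h0; rw [h0] at h; norm_num at h
  have h1 : (4 * (‖β‖ : ℂ) ^ 2) ≠ 0 := by simpa using hβ
  have h2 : ((‖α‖ : ℂ) * ‖β‖) = 1 / 2 := by
    have := congrArg Complex.ofReal h
    push_cast at this
    exact this
  rw [← mul_div_mul_left _ _ h1]
  push_cast
  congr 1
  · linear_combination 4 * ((‖α‖ : ℂ) * ‖β‖ + 1 / 2) * h2
  · linear_combination 4 * ((‖α‖ : ℂ) * ‖β‖ + 1 / 2) * h2

end GenusOneFace

/-! ### Necessity of the two period conditions. -/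

namespace GenusOneFace

open Curve

theorem conj_eq_self_of_sq_eq {u : ℂ} {t : ℝ} (h : u ^ 2 = t) (ht : 0 ≤ t) : conj u = u := by
  have hre := congrArg Complex.re h
  have him := congrArg Complex.im h
  simp only [sq, Complex.mul_re, Complex.mul_im, Complex.ofReal_re, Complex.ofReal_im] at hre him
  rw [Complex.conj_eq_iff_im]
  have : u.re * u.im = 0 := by linarith
  rcases mul_eq_zero.1 this with h0 | h0
  · rw [h0] at hre; nlinarith [mul_self_nonneg u.im]
  · exact h0

theorem conj_eq_neg_of_sq_eq {u : ℂ} {t : ℝ} (h : u ^ 2 = t) (ht : t ≤ 0) : conj u = -u := by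
  have h1 : (Complex.I * u) ^ 2 = ((-t : ℝ) : ℂ) := by
    rw [mul_pow, h, Complex.I_sq]; push_cast; ring
  have h2 := conj_eq_self_of_sq_eq h1 (by linarith)
  rw [map_mul, Complex.conj_I] at h2
  apply mul_left_cancel₀ Complex.I_ne_zero
  linear_combination -h2

theorem conj_mul_symmMatrix_mul (E : Matrix (Fin 2) (Fin 2) ℂ) (p q : ℝ) (i j : Fin 2) :
    conj ((E * symmMatrix p q * Eᴴ) i j) = (E * symmMatrix p q * Eᴴ) j i := by
  rw [mul_symmMatrix_mul, mul_symmMatrix_mul]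
  simp only [map_add, map_mul, Complex.conj_conj, Complex.conj_ofReal]
  ring

variable {a : ℝ}

theorem y_sq_of_real (p : Curve a) {r : ℝ} (hr : z p = r) :
    y p ^ 2 = (((r ^ 2 - 1) * (r ^ 2 - a ^ 2) : ℝ) : ℂ) := by
  have h : y p ^ 2 = (z p ^ 2 - 1) * (z p ^ 2 - (a : ℂ) ^ 2) := p.2
  rw [h, hr]; push_cast; ring

theorem reflection_φ_eq_self {m n : Bool} {p : Curve a} (hz : scalarAut m (z p) = z p)
    (hy : boolSign n * scalarAut m (y p) = y p) : (reflection a m n).φ p = p := ext hz hy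

theorem reflection_conj_eq_self {p : Curve a} {r : ℝ} (hr : z p = r)
    (h : 0 ≤ (r ^ 2 - 1) * (r ^ 2 - a ^ 2)) : (reflection a true false).φ p = p := by
  refine reflection_φ_eq_self (by rw [hr]; exact Complex.conj_ofReal r) ?_
  exact (one_mul _).trans (conj_eq_self_of_sq_eq (y_sq_of_real p hr) h)

theorem reflection_conj_neg_eq_self {p : Curve a} {r : ℝ} (hr : z p = r)
    (h : (r ^ 2 - 1) * (r ^ 2 - a ^ 2) ≤ 0) : (reflection a true true).φ p = p := by
  refine reflection_φ_eq_self (by rw [hr]; exact Complex.conj_ofReal r) ?_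
  change -1 * conj (y p) = y p
  rw [conj_eq_neg_of_sq_eq (y_sq_of_real p hr) h]; ring

theorem mul_nonpos_of_mem_Icc {r : ℝ} (ha : 1 < a) (h1 : 1 ≤ r) (h2 : r ≤ a) :
    (r ^ 2 - 1) * (r ^ 2 - a ^ 2) ≤ 0 :=
  mul_nonpos_of_nonneg_of_nonpos (by nlinarith) (by nlinarith)

theorem mul_nonneg_of_le {r : ℝ} (ha : 1 < a) (h : a ≤ r) :
    0 ≤ (r ^ 2 - 1) * (r ^ 2 - a ^ 2) :=
  mul_nonneg (by nlinarith) (by nlinarith)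

theorem mul_nonneg_of_sq_le {r : ℝ} (ha : 1 < a) (h : r ^ 2 ≤ 1) :
    0 ≤ (r ^ 2 - 1) * (r ^ 2 - a ^ 2) :=
  mul_nonneg_of_nonpos_of_nonpos (by linarith) (by nlinarith)

variable {X : Type*} [TopologicalSpace X] {π : X → Curve a} {c : ℝ}
  {E F : X → Matrix.SpecialLinearGroup (Fin 2) ℂ}

theorem hermitian_of_eq_one {Y : Type*} {E : Y → Matrix.SpecialLinearGroup (Fin 2) ℂ} {x : Y}
    (h : E x = 1) (m : Matrix (Fin 2) (Fin 2) ℂ) : hermitian E m x = m := by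
  rw [hermitian, h, Matrix.SpecialLinearGroup.coe_one, Matrix.conjTranspose_one, Matrix.one_mul,
    Matrix.mul_one]

theorem reflection_conj_act_symmMatrix (p q : ℝ) :
    (reflection a true false).act (symmMatrix p q) = symmMatrix p q := by
  rw [reflection_act]
  ext i j
  fin_cases i <;> fin_cases j <;> simp [symmMatrix, boolSign, scalarAut]

theorem imaginaryReflection_act_symmMatrix (ha : 1 < a) (p q : ℝ) :
    (imaginaryReflection a ha).act (symmMatrix p q) = symmMatrix p q := by
  rw [imaginaryReflection_act]
  ext i j
  fin_cases i <;> fin_cases j <;> simp [symmMatrix]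

/-- The lift of the complex conjugation that fixes the base point. -/
theorem exists_conj_lift [SimplyConnectedSpace X] (ha : 1 < a) (hπ : IsCoveringMap π)
    (hE : IsNullLift c (toM ∘ π) E) {x₀ : X} (hE₀ : E x₀ = 1) (hz₀ : z (π x₀) = 0)
    (hy₀ : y (π x₀) = -a) (p q : ℝ) :
    ∃ h : X → X, Continuous h ∧ (∀ x, π (h x) = (reflection a true false).φ (π x)) ∧ h x₀ = x₀ ∧
      ∀ x, (reflection a true false).act (hermitian E (symmMatrix p q) (h x)) =
        hermitian E (symmMatrix p q) x := by
  have h0 : π x₀ = (reflection a true false).φ (π x₀) := by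
    refine (reflection_φ_eq_self ?_ ?_).symm
    · rw [hz₀, map_zero]
    · rw [hy₀, map_neg, scalarAut_ofReal]; exact one_mul _
  obtain ⟨h, hc, hh, hx⟩ := exists_lift ha hπ (reflection a true false).continuous_φ h0
  refine ⟨h, hc, hh, hx, (reflection a true false).act_hermitian_eq ha hπ hE hc hh (x₁ := x₀) ?_⟩
  rw [hx, hermitian_of_eq_one hE₀, reflection_conj_act_symmMatrix]

/-- The lift of `(z, y) ↦ (-z̄, ȳ)` that fixes the base point. -/
theorem exists_imaginary_lift [SimplyConnectedSpace X] (ha : 1 < a) (hπ : IsCoveringMap π)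
    (hE : IsNullLift c (toM ∘ π) E) {x₀ : X} (hE₀ : E x₀ = 1) (hz₀ : z (π x₀) = 0)
    (hy₀ : y (π x₀) = -a) (p q : ℝ) :
    ∃ h : X → X, Continuous h ∧ (∀ x, π (h x) = (imaginaryReflection a ha).φ (π x)) ∧
      h x₀ = x₀ ∧
      ∀ x, (imaginaryReflection a ha).act (hermitian E (symmMatrix p q) (h x)) =
        hermitian E (symmMatrix p q) x := by
  have h0 : π x₀ = (imaginaryReflection a ha).φ (π x₀) := by
    apply ext
    · change z (π x₀) = -conj (z (π x₀))
      rw [hz₀, map_zero, neg_zero]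
    · change y (π x₀) = conj (y (π x₀))
      rw [hy₀, map_neg, Complex.conj_ofReal]
  obtain ⟨h, hc, hh, hx⟩ := exists_lift ha hπ (imaginaryReflection a ha).continuous_φ h0
  refine ⟨h, hc, hh, hx, (imaginaryReflection a ha).act_hermitian_eq ha hπ hE hc hh (x₁ := x₀) ?_⟩
  rw [hx, hermitian_of_eq_one hE₀, imaginaryReflection_act_symmMatrix]

/-- At x₂ the conjugation fixes the projected point, so descent makes H(x₂) real. At x₁ the
reflection (z̄, -w̄) fixes the projected point but moves the base point, so its constant k has to be
computed and compared with m. -/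
theorem period_conditions_of_descends [SimplyConnectedSpace X] (ha : 1 < a)
    (hπ : IsCoveringMap π) (hE : IsNullLift c (toM ∘ π) E) {x₀ x₁ x₂ : X} (hE₀ : E x₀ = 1)
    (hz₀ : z (π x₀) = 0) (hy₀ : y (π x₀) = -a) {r₁ r₂ : ℝ} (hz₁ : z (π x₁) = r₁)
    (hr₁ : 1 ≤ r₁) (hr₁' : r₁ ≤ a) (hz₂ : z (π x₂) = r₂) (hr₂ : a ≤ r₂) {p q : ℝ}
    (hne : (conj ((E x₁).1 0 0) * (E x₁).1 1 0).re ≠ (conj ((E x₁).1 0 1) * (E x₁).1 1 1).re)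
    (hdesc : ∀ x x', π x = π x' →
      hermitian E (symmMatrix p q) x = hermitian E (symmMatrix p q) x') :
    hermitian E (symmMatrix p q) x₁ 0 1 + hermitian E (symmMatrix p q) x₁ 1 0 = 0 ∧
      hermitian E (symmMatrix p q) x₂ 0 1 = hermitian E (symmMatrix p q) x₂ 1 0 := by
  set H := hermitian E (symmMatrix p q) with hH
  have hHconj : ∀ x i j, conj (H x i j) = H x j i := fun x i j =>
    conj_mul_symmMatrix_mul (E x).1 p q i j
  obtain ⟨h₁, -, hh₁, -, hH₁⟩ := exists_conj_lift ha hπ hE hE₀ hz₀ hy₀ p q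
  obtain ⟨h₂, -, hh₂, -, hH₂⟩ := exists_imaginary_lift ha hπ hE hE₀ hz₀ hy₀ p q
  rw [← hH] at hH₁ hH₂
  have hx₂ : conj (H x₂ 0 1) = H x₂ 0 1 := by
    have h := hH₁ x₂
    rw [hdesc (h₁ x₂) x₂ ((hh₁ x₂).trans
      (reflection_conj_eq_self hz₂ (mul_nonneg_of_le ha hr₂))), reflection_act] at h
    simpa [boolSign, scalarAut] using congrFun (congrFun h 0) 1
  refine ⟨?_, by rw [← hHconj x₂ 0 1, hx₂]⟩
  have hφ₁ := reflection_conj_neg_eq_self hz₁ (mul_nonpos_of_mem_Icc ha hr₁ hr₁')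
  obtain ⟨h, hc, hh, hx⟩ := exists_lift ha hπ (reflection a true true).continuous_φ hφ₁.symm
  have : Nonempty X := ⟨x₀⟩
  obtain ⟨k, hk⟩ := (reflection a true true).exists_act_hermitian_eq ha hπ hE hc hh
    (symmMatrix p q)
  rw [← hH] at hk
  -- A point over (z, w) = (0, -1). Conjugation and (-z̄, 1/w̄) both fix its projection, so descent
  -- gives H(x₃) the shape of `symmMatrix`, with real entries u and v.
  set x₃ := h x₀ with hx₃
  have hz₃ : z (π x₃) = 0 := by
    rw [hx₃, hh]
    change conj (z (π x₀)) = 0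
    rw [hz₀, map_zero]
  have hy₃ : y (π x₃) = a := by
    rw [hx₃, hh]
    change -1 * conj (y (π x₀)) = a
    rw [hy₀, map_neg, Complex.conj_ofReal]; ring
  have e1 : (reflection a true false).act (H x₃) = H x₃ := by
    refine Eq.trans (congrArg _ ?_) (hH₁ x₃)
    refine hdesc x₃ (h₁ x₃) ?_
    rw [hh₁, reflection_φ_eq_self]
    · rw [hz₃, map_zero]
    · rw [hy₃, scalarAut_ofReal]; exact one_mul _
  have e2 : (imaginaryReflection a ha).act (H x₃) = H x₃ := by
    refine Eq.trans (congrArg _ ?_) (hH₂ x₃)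
    refine hdesc x₃ (h₂ x₃) ?_
    rw [hh₂]
    apply ext
    · change z (π x₃) = -conj (z (π x₃))
      rw [hz₃, map_zero, neg_zero]
    · change y (π x₃) = conj (y (π x₃))
      rw [hy₃, Complex.conj_ofReal]
  rw [reflection_act] at e1
  rw [imaginaryReflection_act] at e2
  have r00 : conj (H x₃ 0 0) = H x₃ 0 0 := congrFun (congrFun e1 0) 0
  have r01 : conj (H x₃ 0 1) = H x₃ 0 1 :=
    (one_mul _).symm.trans (congrFun (congrFun e1 0) 1)
  have s11 : conj (H x₃ 0 0) = H x₃ 1 1 := congrFun (congrFun e2 1) 1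
  have s10 : conj (H x₃ 0 1) = H x₃ 1 0 := congrFun (congrFun e2 1) 0
  obtain ⟨u, hu⟩ := Complex.conj_eq_iff_real.1 r00
  obtain ⟨v, hv⟩ := Complex.conj_eq_iff_real.1 r01
  -- E is the identity at x₀, so k = act(H(x₃)); the conjugation by e₃ changes the sign of the
  -- off-diagonal entry.
  have hk0 : k = symmMatrix u (-v) := by
    have := hk x₀
    rw [hermitian_of_eq_one hE₀, reflection_act, ← hx₃, ← s11, ← s10, r00, r01, hu, hv] at this
    rw [← this, symmMatrix]
    simp only [scalarAut_ofReal, boolSign, if_true]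
    ext i j
    fin_cases i <;> fin_cases j <;> simp
  have hk1 := hk x₁
  rw [hx, hk0, reflection_act] at hk1
  set K := hermitian E (symmMatrix u (-v)) x₁ with hK
  have k00 : conj (H x₁ 0 0) = K 0 0 := congrFun (congrFun hk1 0) 0
  have k01 : -1 * conj (H x₁ 0 1) = K 0 1 := congrFun (congrFun hk1 0) 1
  have k10 : -1 * conj (H x₁ 1 0) = K 1 0 := congrFun (congrFun hk1 1) 0
  have k11 : conj (H x₁ 1 1) = K 1 1 := congrFun (congrFun hk1 1) 1
  rw [hHconj] at k00 k01 k10 k11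
  -- K has the diagonal of H(x₁), and both off-diagonal entries of H(x₁) - K equal H₀₁ + H₁₀. Thus m
  -- = k, and H₀₁ = -H₁₀ follows.
  obtain ⟨hpu, hqv⟩ := eq_of_mul_symmMatrix_mul (E x₁).2 hne (p := p) (q := q) (p' := u)
    (q' := -v) k00 k11 (by
      change H x₁ 0 1 - K 0 1 = H x₁ 1 0 - K 1 0
      rw [← k01, ← k10]; ring)
  have hKH : K = H x₁ := by rw [hK, hH, hpu, hqv]
  rw [hKH] at k01
  linear_combination -k01

end GenusOneFace

/-! ### A continuous section over the closed upper half-plane. -/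

namespace GenusOneFace

open Curve

theorem sqrt_conj {u : ℂ} (hu : 0 ≤ u.re) : (conj u).sqrt = conj u.sqrt := by
  have harg : u.arg ≠ Real.pi := by
    rw [Ne, Complex.arg_eq_pi_iff]
    exact fun h => not_lt.2 hu h.1
  rw [Complex.sqrt, Complex.sqrt, Complex.conj_cpow _ _ harg, map_inv₀, map_ofNat]

/-- The square root on the closed upper half-plane with values in the closed first quadrant. -/
def upperSqrt (u : ℂ) : ℂ := Complex.I.sqrt * (-Complex.I * u).sqrt

theorem upperSqrt_sq (u : ℂ) : upperSqrt u ^ 2 = u := by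
  rw [upperSqrt, mul_pow, sqrt_sq, sqrt_sq]
  linear_combination -u * Complex.I_sq

/-- The reflection u ↦ -ū sends the argument θ to π - θ; halving gives π/2 - θ/2, the reflection v ↦
i v̄ of the first quadrant. -/
theorem upperSqrt_neg_conj {u : ℂ} (hu : 0 ≤ u.im) :
    upperSqrt (-conj u) = Complex.I * conj (upperSqrt u) := by
  have h1 : -Complex.I * -conj u = conj (-Complex.I * u) := by
    simp
  have h2 : 0 ≤ (-Complex.I * u).re := by simpa using hu
  have h3 : Complex.I.sqrt * conj Complex.I.sqrt = 1 := by
    have h : ‖Complex.I.sqrt‖ ^ 2 = 1 := by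
      rw [← norm_pow, sqrt_sq, Complex.norm_I]
    rw [Complex.mul_conj']
    exact_mod_cast h
  have h4 := sqrt_sq Complex.I
  rw [upperSqrt, upperSqrt, h1, sqrt_conj h2, map_mul]
  generalize conj (-Complex.I * u).sqrt = v
  linear_combination (-(v * Complex.I.sqrt)) * h3 + v * conj Complex.I.sqrt * h4

theorem upperSqrt_mul_upperSqrt_neg {r : ℝ} (hr : 0 ≤ r) :
    upperSqrt r * upperSqrt (-r) = Complex.I * r := by
  have h1 := upperSqrt_neg_conj (u := (r : ℂ)) (by simp)
  rw [Complex.conj_ofReal] at h1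
  have h2 : ‖upperSqrt r‖ ^ 2 = r := by
    rw [← norm_pow, upperSqrt_sq, Complex.norm_real, Real.norm_of_nonneg hr]
  have h3 := Complex.mul_conj' (upperSqrt r)
  rw [h1, mul_left_comm, h3]
  congr 1
  exact_mod_cast h2

theorem continuousOn_upperSqrt : ContinuousOn upperSqrt {u | 0 ≤ u.im} := by
  intro u hu
  have h : ContinuousAt Complex.sqrt (-Complex.I * u) :=
    Complex.continuousAt_cpow_const_of_re_pos (Or.inl (by simpa using hu)) (by norm_num)
  exact (continuousAt_const.mul (ContinuousAt.comp (f := fun u => -Complex.I * u) h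
    (by fun_prop))).continuousWithinAt

/-- The reflection of the lower half-plane to the upper half-plane. -/
def fold (u : ℂ) : ℂ := ⟨u.re, |u.im|⟩

theorem continuous_fold : Continuous fold := by
  have : fold = fun u => ((u.re : ℂ) + (|u.im| : ℝ) * Complex.I) := by
    funext u; exact Complex.mk_eq_add_mul_I _ _
  rw [this]
  fun_prop

theorem fold_eq_self_iff (u : ℂ) : fold u = u ↔ 0 ≤ u.im := by
  rw [fold, Complex.ext_iff]
  simp

theorem fold_im_nonneg (u : ℂ) : 0 ≤ (fold u).im := abs_nonneg _

theorem fold_neg_conj (u : ℂ) : fold (-conj u) = -conj (fold u) := by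
  simp [fold, Complex.ext_iff]

variable {a : ℝ}

/-- The branch of `y` on the upper half-plane, extended by reflection. -/
def branchY (a : ℝ) (u : ℂ) : ℂ :=
  upperSqrt (fold u - 1) * upperSqrt (fold u + 1) *
    (upperSqrt (fold u - a) * upperSqrt (fold u + a))

theorem branchY_sq (u : ℂ) :
    branchY a u ^ 2 = (fold u ^ 2 - 1) * (fold u ^ 2 - (a : ℂ) ^ 2) := by
  simp only [branchY, mul_pow, upperSqrt_sq]; ring

theorem continuous_branchY : Continuous (branchY a) := by
  have h : ∀ v : ℂ, v.im = 0 → Continuous fun u => upperSqrt (fold u + v) := fun v hv =>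
    continuousOn_upperSqrt.comp_continuous (continuous_fold.add continuous_const) fun u => by
      change 0 ≤ (fold u + v).im
      rw [Complex.add_im, hv, add_zero]; exact fold_im_nonneg u
  unfold branchY
  simp only [sub_eq_add_neg]
  exact ((h _ (by simp)).mul (h _ (by simp))).mul ((h _ (by simp)).mul (h _ (by simp)))

/-- Each pair of opposite square roots contributes a factor i. The value -a is y at the base point,
where w = 1. -/
theorem branchY_zero (ha : 1 < a) : branchY a 0 = -a := by
  have h0 : fold 0 = 0 := (fold_eq_self_iff 0).2 le_rfl
  have h1 := upperSqrt_mul_upperSqrt_neg (zero_le_one' ℝ)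
  have h2 := upperSqrt_mul_upperSqrt_neg (r := a) (by linarith)
  push_cast at h1
  rw [branchY, h0, zero_sub, zero_add, zero_sub, zero_add, mul_comm (upperSqrt (-1)), h1,
    mul_comm (upperSqrt (-a)), h2]
  linear_combination a * Complex.I_sq

/-- The reflection exchanges the factors for v and -v and produces one factor i from each of the
four roots, with i⁴ = 1. -/
theorem branchY_neg_conj (u : ℂ) : branchY a (-conj u) = conj (branchY a u) := by
  have h : ∀ v : ℝ, upperSqrt (fold (-conj u) + v) =
      Complex.I * conj (upperSqrt (fold u - v)) := fun v => by
    rw [fold_neg_conj, ← upperSqrt_neg_conj (by simpa using fold_im_nonneg u), map_sub,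
      Complex.conj_ofReal]
    congr 1; ring
  have h1 := h 1
  have h2 := h (-1)
  have h3 := h a
  have h4 := h (-a)
  push_cast at h1 h2 h3 h4
  rw [← sub_eq_add_neg, sub_neg_eq_add] at h2 h4
  rw [branchY, branchY, h1, h2, h3, h4]
  simp only [map_mul]
  generalize conj (upperSqrt _) = v₁
  generalize conj (upperSqrt _) = v₂
  generalize conj (upperSqrt _) = v₃
  generalize conj (upperSqrt _) = v₄
  linear_combination v₁ * v₂ * v₃ * v₄ * (Complex.I ^ 2 - 1) * Complex.I_sq

/-- The map `z ↦ (z, y(z))` on the upper half-plane, extended by reflection. -/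
def upperSection (a : ℝ) (u : ℂ) : Curve a := ⟨(fold u, branchY a u), branchY_sq u⟩

theorem continuous_upperSection : Continuous (upperSection a) :=
  (continuous_fold.prodMk continuous_branchY).subtype_mk _

theorem upperSection_neg_conj (ha : 1 < a) (u : ℂ) :
    upperSection a (-conj u) = (imaginaryReflection a ha).φ (upperSection a u) :=
  ext (fold_neg_conj u) (branchY_neg_conj u)

theorem im_nonneg_of_upperSection_z_eq {q : Curve a} (h : upperSection a (z q) = q) : 0 ≤ (z q).im :=
  (fold_eq_self_iff _).1 (congrArg z h)

theorem upperSection_z_eq {q : Curve a} (h : 0 ≤ (z q).im) (h' : y q = branchY a (z q)) :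
    upperSection a (z q) = q :=
  ext ((fold_eq_self_iff _).2 h) h'.symm

theorem y_sq_eq_branchY_sq {q : Curve a} (h : 0 ≤ (z q).im) : y q ^ 2 = branchY a (z q) ^ 2 := by
  rw [branchY_sq, (fold_eq_self_iff _).2 h]; exact q.2

theorem z_reflection (m n : Bool) (q : Curve a) :
    z ((reflection a m n).φ q) = scalarAut m (z q) := rfl

theorem y_reflection (m n : Bool) (q : Curve a) :
    y ((reflection a m n).φ q) = boolSign n * scalarAut m (y q) := rfl

/-- The four reflected copies of the tile cover the curve: conjugation puts z in the upper
half-plane, and the sign of y then selects the sheet. -/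
theorem exists_reflection_mem (q : Curve a) :
    ∃ m n, upperSection a (z ((reflection a m n).φ q)) = (reflection a m n).φ q := by
  obtain ⟨m, hm⟩ : ∃ m, 0 ≤ (scalarAut m (z q)).im := by
    rcases le_total 0 (z q).im with h | h
    · exact ⟨false, h⟩
    · exact ⟨true, by simpa [scalarAut] using h⟩
  have h1 := y_sq_eq_branchY_sq (q := (reflection a m false).φ q) hm
  rcases sq_eq_sq_iff_eq_or_eq_neg.1 h1 with h | h
  · exact ⟨m, false, upperSection_z_eq hm h⟩
  · refine ⟨m, true, upperSection_z_eq hm ?_⟩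
    rw [y_reflection] at h ⊢
    rw [z_reflection] at h ⊢
    simp only [boolSign] at h ⊢
    simp only [if_true, Bool.false_eq_true, if_false] at h ⊢
    linear_combination -h

theorem reflection_φ_comp (m n m' n' : Bool) (q : Curve a) :
    (reflection a m n).φ ((reflection a m' n').φ q) = (reflection a (m ^^ m') (n ^^ n')).φ q := by
  apply ext
  · simp only [z_reflection]
    cases m <;> cases m' <;> simp [scalarAut]
  · simp only [y_reflection]
    cases m <;> cases m' <;> cases n <;> cases n' <;> simp [scalarAut, boolSign]

theorem reflection_act_comp (m n m' n' : Bool) (A : Matrix (Fin 2) (Fin 2) ℂ) :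
    (reflection a m n).act ((reflection a m' n').act A) =
      (reflection a (m ^^ m') (n ^^ n')).act A := by
  simp only [reflection_act]
  cases m <;> cases m' <;> cases n <;> cases n' <;> simp [scalarAut, boolSign]

theorem reflection_act_self (A : Matrix (Fin 2) (Fin 2) ℂ) :
    (reflection a false false).act A = A := by
  rw [reflection_act]
  ext i j
  fin_cases i <;> fin_cases j <;> simp [scalarAut, boolSign]

theorem reflection_act_imaginaryReflection_act (ha : 1 < a) (m n : Bool)
    (A : Matrix (Fin 2) (Fin 2) ℂ) :
    (reflection a m n).act ((imaginaryReflection a ha).act A) =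
      (imaginaryReflection a ha).act ((reflection a m n).act A) := by
  simp only [reflection_act, imaginaryReflection_act]
  cases m <;> cases n <;> simp [scalarAut, boolSign]

end GenusOneFace

/-! ### The lifted section, the given curves and propagation along fixed segments. -/

namespace GenusOneFace

open Curve

variable {a : ℝ} {X : Type*} [TopologicalSpace X] {π : X → Curve a} {c : ℝ}
  {E F : X → Matrix.SpecialLinearGroup (Fin 2) ℂ}

theorem continuous_of_isNullLift (ha : 1 < a) (hπ : IsCoveringMap π)
    (hE : IsNullLift c (toM ∘ π) E) : Continuous fun x => (E x).1 := by
  rw [continuous_iff_continuousAt]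
  intro x
  obtain ⟨e, hxe, he⟩ := exists_chart_of_isCoveringMap ha hπ x
  obtain ⟨g, hga, hg, -⟩ := (isNullLift_toM_iff ha).1 hE x
  rw [← he x hxe] at hga
  have hgc : ContinuousAt g (e x) :=
    continuousAt_pi.2 fun i => continuousAt_pi.2 fun j => (hga i j).continuousAt
  refine (ContinuousAt.comp hgc (e.continuousAt hxe)).congr ?_
  filter_upwards [hg, e.open_source.mem_nhds hxe] with x' h1 h2
  rw [h1, Function.comp_apply, he x' h2]

theorem continuous_hermitian (ha : 1 < a) (hπ : IsCoveringMap π)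
    (hE : IsNullLift c (toM ∘ π) E) (m : Matrix (Fin 2) (Fin 2) ℂ) :
    Continuous (hermitian E m) := by
  have h := continuous_of_isNullLift ha hπ hE
  exact (h.matrix_mul continuous_const).matrix_mul h.matrix_conjTranspose

/-- Identifies the end points of the lifted curves with values of the section. Along the curve, y is
a square root of the square of `branchY`, which vanishes nowhere before time 1, so the sign agreed
at the base point persists; time 1 follows by closure. -/
theorem upperSection_eq_lift (hπ : IsCoveringMap π) {s : ℂ → X} (hs : Continuous s)
    (hπs : ∀ u, π (s u) = upperSection a u) {C : C(I, X)} (hC₀ : C 0 = s 0)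
    (hz₀ : z (π (C 0)) = 0) (hC : ∀ t : I, t ≠ 0 → t ≠ 1 → 0 < (z (π (C t))).im)
    (hC₁ : 0 ≤ (z (π (C 1))).im) (ha : 1 < a) (t : I) : C t = s (z (π (C t))) := by
  have hzc : Continuous fun t => z (π (C t)) := continuous_z.comp (hπ.continuous.comp C.continuous)
  have hyc : Continuous fun t => y (π (C t)) := continuous_y.comp (hπ.continuous.comp C.continuous)
  have him : ∀ t : I, 0 ≤ (z (π (C t))).im := fun t => by
    by_cases h0 : t = 0
    · rw [h0, hz₀]; simp
    · by_cases h1 : t = 1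
      · rw [h1]; exact hC₁
      · exact (hC t h0 h1).le
  have hne : ∀ t : I, t ∈ Set.Iio (1 : I) → branchY a (z (π (C t))) ≠ 0 := by
    intro t ht h0
    have h1 : t ≠ 1 := ne_of_lt ht
    have h2 := branchY_sq (a := a) (z (π (C t)))
    rw [h0, (fold_eq_self_iff _).2 (him t), sq, zero_mul] at h2
    by_cases h3 : t = 0
    · rw [h3, hz₀] at h2
      have : (a : ℂ) ≠ 0 := by exact_mod_cast (by linarith : a ≠ 0)
      apply this
      simpa using h2.symm
    · have h4 := hC t h3 h1
      rcases mul_eq_zero.1 h2.symm with h5 | h5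
      · rw [sub_eq_zero, ← one_pow 2, sq_eq_sq_iff_eq_or_eq_neg] at h5
        rcases h5 with h5 | h5 <;> rw [h5] at h4 <;> simp at h4
      · rw [sub_eq_zero, sq_eq_sq_iff_eq_or_eq_neg] at h5
        rcases h5 with h5 | h5 <;> rw [h5] at h4 <;> simp at h4
  have hEq : Set.EqOn (fun t => y (π (C t))) (fun t => branchY a (z (π (C t))))
      (Set.Iio (1 : I)) := by
    refine IsPreconnected.eq_of_sq_eq isPreconnected_Iio hyc.continuousOn
      (continuous_branchY.comp hzc).continuousOn (fun t _ => y_sq_eq_branchY_sq (him t))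
      (fun {t} ht => hne t ht) (y := 0) (by simp) ?_
    rw [hC₀, hπs]
    change branchY a 0 = branchY a (fold 0)
    rw [(fold_eq_self_iff 0).2 le_rfl]
  have hall : ∀ t, π (C t) = upperSection a (z (π (C t))) := by
    have hcl : IsClosed {t : I | π (C t) = upperSection a (z (π (C t)))} :=
      isClosed_eq (hπ.continuous.comp C.continuous) (continuous_upperSection.comp hzc)
    have hd : Dense ({1}ᶜ : Set I) := dense_compl_singleton 1
    have hsub : ({1}ᶜ : Set I) ⊆ {t : I | π (C t) = upperSection a (z (π (C t)))} :=
      fun t ht => (upperSection_z_eq (him t) (hEq (lt_top_iff_ne_top.2 ht))).symm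
    exact fun t => hcl.closure_subset_iff.2 hsub (hd t)
  have := hπ.eq_of_comp_eq C.continuous (hs.comp hzc)
    (funext fun t => (hall t).trans (hπs _).symm) 0 (by
      change C 0 = s (z (π (C 0)))
      rw [hz₀, hC₀])
  exact congrFun this t

/-- A lift of the symmetry that fixes one lifted point of a pointwise fixed segment fixes the whole
lifted segment, so invariance at one point spreads along it. -/
theorem act_hermitian_section_eq [SimplyConnectedSpace X] (ha : 1 < a) (hπ : IsCoveringMap π)
    (hE : IsNullLift c (toM ∘ π) E) {s : ℂ → X} (hs : Continuous s)
    (hπs : ∀ u, π (s u) = upperSection a u) (S : CurveSymmetry a)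
    {m : Matrix (Fin 2) (Fin 2) ℂ} {J : Set ℝ} (hJ : IsPreconnected J)
    (hfix : ∀ r ∈ J, S.φ (upperSection a r) = upperSection a r) {r₀ : ℝ} (hr₀ : r₀ ∈ J)
    (h₀ : S.act (hermitian E m (s r₀)) = hermitian E m (s r₀)) {r : ℝ} (hr : r ∈ J) :
    S.act (hermitian E m (s r)) = hermitian E m (s r) := by
  obtain ⟨h, hc, hh, hx⟩ := exists_lift ha hπ S.continuous_φ (x := s r₀) (x' := s r₀)
    (by rw [hπs, hfix r₀ hr₀])
  have hsc : Continuous fun r : ℝ => s r := hs.comp Complex.continuous_ofReal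
  have heq : Set.EqOn (fun r : ℝ => h (s r)) (fun r : ℝ => s r) J :=
    hπ.eqOn_of_comp_eqOn hJ (hc.comp hsc).continuousOn hsc.continuousOn
      (fun r hr => by
        change π (h (s r)) = π (s r)
        rw [hh, hπs, hfix r hr]) hr₀ hx
  have h1 := S.act_hermitian_eq ha hπ hE hc hh (m := m) (x₁ := s r₀) (by rw [hx, h₀]) (s r)
  rwa [show h (s r) = s r from heq hr] at h1

end GenusOneFace

/-! ### Sufficiency: extension by reflection. -/

namespace GenusOneFace

open Curve

variable {a : ℝ} {X : Type*} [TopologicalSpace X] {π : X → Curve a} {c : ℝ}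
  {E F : X → Matrix.SpecialLinearGroup (Fin 2) ℂ}

theorem z_upperSection_ofReal (r : ℝ) : z (upperSection a r) = r :=
  (fold_eq_self_iff _).2 (by simp)

section Descent

variable {s : ℂ → X} {m : Matrix (Fin 2) (Fin 2) ℂ}

theorem act_conj_section_eq [SimplyConnectedSpace X] (ha : 1 < a) (hπ : IsCoveringMap π)
    (hE : IsNullLift c (toM ∘ π) E) (hs : Continuous s) (hπs : ∀ u, π (s u) = upperSection a u)
    (h0 : (reflection a true false).act (hermitian E m (s 0)) = hermitian E m (s 0))
    (him : ∀ u, (imaginaryReflection a ha).act (hermitian E m (s (-conj u))) = hermitian E m (s u))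
    {r₂ : ℝ} (hr₂ : a ≤ r₂)
    (h₂ : (reflection a true false).act (hermitian E m (s r₂)) = hermitian E m (s r₂))
    {r : ℝ} (hr : 0 ≤ (r ^ 2 - 1) * (r ^ 2 - a ^ 2)) :
    (reflection a true false).act (hermitian E m (s r)) = hermitian E m (s r) := by
  have hfix : ∀ r : ℝ, 0 ≤ (r ^ 2 - 1) * (r ^ 2 - a ^ 2) →
      (reflection a true false).φ (upperSection a r) = upperSection a r := fun r hr =>
    reflection_conj_eq_self (z_upperSection_ofReal r) hr
  have hge : ∀ r : ℝ, a ≤ r →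
      (reflection a true false).act (hermitian E m (s r)) = hermitian E m (s r) := fun r hr =>
    act_hermitian_section_eq ha hπ hE hs hπs _ (isPreconnected_Ici (a := a))
      (fun r hr => hfix r (mul_nonneg_of_le ha hr)) hr₂ h₂ hr
  by_cases h1 : r ^ 2 ≤ 1
  · refine act_hermitian_section_eq ha hπ hE hs hπs _ (isPreconnected_Icc (a := -1) (b := 1))
      (fun r hr => hfix r (mul_nonneg_of_sq_le ha (by nlinarith [hr.1, hr.2]))) (r₀ := 0)
      (by simp) (by simpa using h0) (abs_le.1 ((sq_le_one_iff_abs_le_one r).1 h1))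
  · have h2 : a ^ 2 ≤ r ^ 2 := by
      by_contra h
      push Not at h h1
      nlinarith [mul_pos (sub_pos.2 h1) (sub_pos.2 h)]
    rcases le_total 0 r with h3 | h3
    · exact hge r (by nlinarith)
    -- The segment (-∞, -a] is the mirror image of [a, ∞) under z ↦ -z̄, whose matrix action
    -- commutes with the reflections.
    · have h4 := him r
      rw [Complex.conj_ofReal, ← Complex.ofReal_neg] at h4
      rw [← h4, reflection_act_imaginaryReflection_act, hge (-r) (by nlinarith)]

theorem act_conj_neg_section_eq [SimplyConnectedSpace X] (ha : 1 < a) (hπ : IsCoveringMap π)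
    (hE : IsNullLift c (toM ∘ π) E) (hs : Continuous s) (hπs : ∀ u, π (s u) = upperSection a u)
    (him : ∀ u, (imaginaryReflection a ha).act (hermitian E m (s (-conj u))) = hermitian E m (s u))
    {r₁ : ℝ} (hr₁ : 1 ≤ r₁) (hr₁' : r₁ ≤ a)
    (h₁ : (reflection a true true).act (hermitian E m (s r₁)) = hermitian E m (s r₁))
    {r : ℝ} (hr : (r ^ 2 - 1) * (r ^ 2 - a ^ 2) ≤ 0) :
    (reflection a true true).act (hermitian E m (s r)) = hermitian E m (s r) := by
  have hmem : ∀ r : ℝ, r ∈ Set.Icc 1 a →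
      (reflection a true true).act (hermitian E m (s r)) = hermitian E m (s r) := fun r hr =>
    act_hermitian_section_eq ha hπ hE hs hπs _ (isPreconnected_Icc (a := 1) (b := a))
      (fun r hr => reflection_conj_neg_eq_self (z_upperSection_ofReal r)
        (mul_nonpos_of_mem_Icc ha hr.1 hr.2)) ⟨hr₁, hr₁'⟩ h₁ hr
  have h1 : 1 ≤ r ^ 2 := by
    by_contra h
    push Not at h
    nlinarith [mul_pos (sub_pos.2 h) (by nlinarith : 0 < a ^ 2 - r ^ 2)]
  have h2 : r ^ 2 ≤ a ^ 2 := by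
    by_contra h
    push Not at h
    nlinarith [mul_pos (sub_pos.2 h) (by nlinarith : 0 < r ^ 2 - 1)]
  rcases le_total 0 r with h3 | h3
  · exact hmem r ⟨by nlinarith, by nlinarith⟩
  · have h4 := him r
    rw [Complex.conj_ofReal, ← Complex.ofReal_neg] at h4
    rw [← h4, reflection_act_imaginaryReflection_act, hmem (-r) ⟨by nlinarith, by nlinarith⟩]

theorem nonneg_of_sq_eq_ofReal {u : ℂ} {t : ℝ} (h : u ^ 2 = t) (hu : conj u = u) : 0 ≤ t := by
  obtain ⟨r, rfl⟩ := Complex.conj_eq_iff_real.1 hu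
  have : r ^ 2 = t := by exact_mod_cast h
  rw [← this]; positivity

/-- The symmetries that fix a point of the closed upper half-plane fix the Hermitian matrix. -/
theorem act_section_eq_of_fix {H : ℂ → Matrix (Fin 2) (Fin 2) ℂ}
    (h₁ : ∀ r : ℝ, 0 ≤ (r ^ 2 - 1) * (r ^ 2 - a ^ 2) →
      (reflection a true false).act (H r) = H r)
    (h₂ : ∀ r : ℝ, (r ^ 2 - 1) * (r ^ 2 - a ^ 2) ≤ 0 →
      (reflection a true true).act (H r) = H r)
    (m n : Bool) {q : Curve a} (hq : (reflection a m n).φ q = q) :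
    (reflection a m n).act (H (z q)) = H (z q) := by
  have hz := congrArg z hq
  have hy := congrArg y hq
  rw [z_reflection] at hz
  rw [y_reflection] at hy
  cases m
  · cases n
    · exact reflection_act_self _
    · change -1 * y q = y q at hy
      have hy0 : y q = 0 := by linear_combination -hy / 2
      have hz' : ∃ r : ℝ, z q = r := by
        rcases (y_eq_zero_iff q).1 hy0 with h | h <;> rcases mul_eq_zero.1 h with h | h
        · exact ⟨-1, by push_cast; linear_combination h⟩
        · exact ⟨a, by linear_combination h⟩
        · exact ⟨1, by push_cast; linear_combination h⟩
        · exact ⟨-a, by push_cast; linear_combination h⟩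
      obtain ⟨r, hr⟩ := hz'
      have h := y_sq_of_real q hr
      rw [hy0] at h
      have h0 : (r ^ 2 - 1) * (r ^ 2 - a ^ 2) = 0 := by
        apply Complex.ofReal_injective
        rw [← h]; simp
      rw [hr]
      -- At a branch point both conjugations fix the point, and the sheet exchange is their product.
      have e := reflection_act_comp (a := a) true false true true (H r)
      rw [h₂ r h0.le, h₁ r h0.ge] at e
      exact e.symm
  · obtain ⟨r, hr⟩ := Complex.conj_eq_iff_real.1 hz
    have h := y_sq_of_real q hr
    rw [hr]
    cases n
    · refine h₁ r (nonneg_of_sq_eq_ofReal h ?_)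
      exact (one_mul _).symm.trans hy
    · refine h₂ r ?_
      change -1 * conj (y q) = y q at hy
      have h' : (Complex.I * y q) ^ 2 = ((-((r ^ 2 - 1) * (r ^ 2 - a ^ 2)) : ℝ) : ℂ) := by
        rw [mul_pow, h, Complex.I_sq]; push_cast; ring
      have := nonneg_of_sq_eq_ofReal h' (by
        rw [map_mul, Complex.conj_I]; linear_combination Complex.I * hy)
      linarith

theorem z_eq_of_mem {q : Curve a} {m n m' n' : Bool}
    (h : upperSection a (z ((reflection a m n).φ q)) = (reflection a m n).φ q)
    (h' : upperSection a (z ((reflection a m' n').φ q)) = (reflection a m' n').φ q) :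
    z ((reflection a m n).φ q) = z ((reflection a m' n').φ q) := by
  have h1 := im_nonneg_of_upperSection_z_eq h
  have h2 := im_nonneg_of_upperSection_z_eq h'
  simp only [z_reflection] at *
  cases m <;> cases m' <;> simp [scalarAut, Complex.ext_iff] at * <;> linarith

/-- On each of the four tiles the reflected values of H on the section define a function of π x
alone. These functions match on overlaps, and the set where H equals them is closed, open and
nonempty. -/
theorem descends_of_section_symmetric [SimplyConnectedSpace X] (ha : 1 < a)
    (hπ : IsCoveringMap π) (hE : IsNullLift c (toM ∘ π) E) (hs : Continuous s)
    (hπs : ∀ u, π (s u) = upperSection a u)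
    (h₁ : ∀ r : ℝ, 0 ≤ (r ^ 2 - 1) * (r ^ 2 - a ^ 2) →
      (reflection a true false).act (hermitian E m (s r)) = hermitian E m (s r))
    (h₂ : ∀ r : ℝ, (r ^ 2 - 1) * (r ^ 2 - a ^ 2) ≤ 0 →
      (reflection a true true).act (hermitian E m (s r)) = hermitian E m (s r))
    (x x' : X) (hxx' : π x = π x') : hermitian E m x = hermitian E m x' := by
  set H := hermitian E m with hH
  let φ : Bool → Bool → Curve a → Curve a := fun i j => (reflection a i j).φ
  have hφ : ∀ i j, Continuous (φ i j) := fun i j => (reflection a i j).continuous_φ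
  let A : Bool → Bool → Set X := fun i j =>
    {x | upperSection a (z (φ i j (π x))) = φ i j (π x)}
  have hA : ∀ i j, IsClosed (A i j) := fun i j => isClosed_eq
    (continuous_upperSection.comp (continuous_z.comp ((hφ i j).comp hπ.continuous)))
    ((hφ i j).comp hπ.continuous)
  let K : Bool → Bool → X → Matrix (Fin 2) (Fin 2) ℂ := fun i j x =>
    (reflection a i j).act (H (s (z (φ i j (π x)))))
  have hHc : Continuous H := continuous_hermitian ha hπ hE m
  have hsφ : ∀ i j, Continuous fun x => s (z (φ i j (π x))) := fun i j =>
    hs.comp (continuous_z.comp ((hφ i j).comp hπ.continuous))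
  have hK : ∀ i j, Continuous (K i j) := fun i j =>
    (reflection a i j).continuous_act.comp (hHc.comp (hsφ i j))
  have hAex : ∀ x, ∃ i j, x ∈ A i j := fun x => exists_reflection_mem (π x)
  -- If two reflections send π x into the tile, they send it to the same point, which is fixed by
  -- their product; that product therefore fixes H there.
  have hcons : ∀ x i j i' j', x ∈ A i j → x ∈ A i' j' → K i j x = K i' j' x := by
    intro x i j i' j' hx hx'
    have hz : z (φ i j (π x)) = z (φ i' j' (π x)) := z_eq_of_mem hx hx'
    have hφφ : φ i j (π x) = φ i' j' (π x) := by
      rw [← (show _ = φ i j (π x) from hx), hz]; exact hx'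
    have hfix : (reflection a (i' ^^ i) (j' ^^ j)).φ (φ i j (π x)) = φ i j (π x) := by
      have h := reflection_φ_comp (a := a) (i' ^^ i) (j' ^^ j) i j (π x)
      rw [show (reflection a i j).φ (π x) = φ i j (π x) from rfl] at h
      rw [h, hφφ]
      simp [φ]
    have h := act_section_eq_of_fix (H := fun u => H (s u)) h₁ h₂ (i' ^^ i) (j' ^^ j) hfix
    change (reflection a i j).act (H (s (z (φ i j (π x))))) =
      (reflection a i' j').act (H (s (z (φ i' j' (π x)))))
    rw [← hz]
    conv_rhs => rw [← h, reflection_act_comp]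
    simp
  -- The lift of the reflection through the section point over x stays, within the tile, on the same
  -- sheet as the section near x, so equality at x spreads to nearby points of the tile.
  have hlocal : ∀ x i j, (x ∈ A i j → H x = K i j x) →
      ∀ᶠ x' in 𝓝 x, x' ∈ A i j → H x' = K i j x' := by
    intro x i j hx
    by_cases hxA : x ∈ A i j
    · obtain ⟨h, hc, hh, hhx⟩ := exists_lift ha hπ (hφ i j) (x := x)
        (x' := s (z (φ i j (π x)))) (by rw [hπs]; exact hxA)
      have hact := (reflection a i j).act_hermitian_eq ha hπ hE hc hh (m := m) (x₁ := x)
        (by rw [hhx]; exact (hx hxA).symm)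
      obtain ⟨e, hxe, he⟩ := hπ.isLocalHomeomorph (h x)
      have hmem : s (z (φ i j (π x))) ∈ e.source := by rw [← hhx]; exact hxe
      have hse : ∀ᶠ x' in 𝓝 x, s (z (φ i j (π x'))) ∈ e.source :=
        (hsφ i j).continuousAt.eventually (e.open_source.mem_nhds hmem)
      filter_upwards [hc.continuousAt.eventually (e.open_source.mem_nhds hxe), hse]
        with x' h3 h4 h5
      have h6 : h x' = s (z (φ i j (π x'))) := by
        refine e.injOn h3 h4 ?_
        rw [← he, hh, hπs]; exact h5.symm
      rw [hH, ← hact x', h6]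
    · filter_upwards [(hA i j).isOpen_compl.mem_nhds hxA] with x' hx' hx''
      exact (hx' hx'').elim
  let G : Set X := {x | ∃ i j, x ∈ A i j ∧ H x = K i j x}
  have hGall : ∀ x ∈ G, ∀ i j, x ∈ A i j → H x = K i j x := by
    rintro x ⟨i, j, hxA, hx⟩ i' j' hx'
    rw [hx]; exact hcons x i j i' j' hxA hx'
  have hGclosed : IsClosed G := by
    have : G = ⋃ i, ⋃ j, A i j ∩ {x | H x = K i j x} := by
      ext x; simp [G]
    rw [this]
    exact isClosed_iUnion_of_finite fun i => isClosed_iUnion_of_finite fun j =>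
      (hA i j).inter (isClosed_eq hHc (hK i j))
  have hGopen : IsOpen G := by
    rw [isOpen_iff_mem_nhds]
    intro x hx
    filter_upwards [Filter.eventually_all.2 fun i => Filter.eventually_all.2 fun j =>
      hlocal x i j (hGall x hx i j)] with x' hx'
    obtain ⟨i, j, hij⟩ := hAex x'
    exact ⟨i, j, hij, hx' i j hij⟩
  have hz0 : z (upperSection a 0) = 0 := (fold_eq_self_iff 0).2 le_rfl
  have hφ0 : φ false false (π (s 0)) = upperSection a 0 := by
    rw [hπs]; exact ext rfl (one_mul _)
  have hGne : s 0 ∈ G := by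
    refine ⟨false, false, ?_, ?_⟩
    · change upperSection a (z (φ false false (π (s 0)))) = φ false false (π (s 0))
      rw [hφ0, hz0]
    · change H (s 0) = (reflection a false false).act (H (s (z (φ false false (π (s 0))))))
      rw [hφ0, hz0, reflection_act_self]
  have hGuniv : G = Set.univ := IsClopen.eq_univ ⟨hGclosed, hGopen⟩ ⟨s 0, hGne⟩
  have hmem : ∀ x, x ∈ G := fun x => hGuniv ▸ Set.mem_univ x
  obtain ⟨i, j, hij⟩ := hAex x
  have hij' : x' ∈ A i j := by
    change upperSection a (z (φ i j (π x'))) = φ i j (π x')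
    rw [← hxx']; exact hij
  rw [hGall x (hmem x) i j hij, hGall x' (hmem x') i j hij']
  simp only [K, hxx']

end Descent

/-- H is Hermitian, so `h₁` is invariance of H under the action of (z̄, -w̄) at s(r₁), and `h₂` is
invariance under that of (z̄, w̄) at s(r₂). Invariance at s(0) holds because E is the identity there
and m is real. -/
theorem descends_of_period_conditions [SimplyConnectedSpace X] (ha : 1 < a)
    (hπ : IsCoveringMap π) (hE : IsNullLift c (toM ∘ π) E) {s : ℂ → X} (hs : Continuous s)
    (hπs : ∀ u, π (s u) = upperSection a u) (hE₀ : E (s 0) = 1) {r₁ r₂ : ℝ}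
    (hr₁ : 1 ≤ r₁) (hr₁' : r₁ ≤ a) (hr₂ : a ≤ r₂) {p q : ℝ}
    (h₁ : hermitian E (symmMatrix p q) (s r₁) 0 1 + hermitian E (symmMatrix p q) (s r₁) 1 0 = 0)
    (h₂ : hermitian E (symmMatrix p q) (s r₂) 0 1 = hermitian E (symmMatrix p q) (s r₂) 1 0)
    (x x' : X) (hxx' : π x = π x') :
    hermitian E (symmMatrix p q) x = hermitian E (symmMatrix p q) x' := by
  have hz₀ : z (π (s 0)) = 0 := by rw [hπs]; exact (fold_eq_self_iff 0).2 le_rfl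
  have hy₀ : y (π (s 0)) = -a := by rw [hπs]; exact branchY_zero ha
  have hconj : ∀ x i j, conj (hermitian E (symmMatrix p q) x i j) =
      hermitian E (symmMatrix p q) x j i := fun x i j =>
    conj_mul_symmMatrix_mul (E x).1 p q i j
  obtain ⟨h, hc, hh, hx, hact⟩ := exists_imaginary_lift ha hπ hE hE₀ hz₀ hy₀ p q
  have hcc : Continuous fun u : ℂ => -conj u := Complex.continuous_conj.neg
  have hhs : h ∘ s = s ∘ fun u => -conj u :=
    hπ.eq_of_comp_eq (hc.comp hs) (hs.comp hcc) (funext fun u => by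
      simp only [Function.comp_apply]
      rw [hh, hπs, hπs, upperSection_neg_conj ha]) 0 (by simp [hx])
  have him : ∀ u, (imaginaryReflection a ha).act (hermitian E (symmMatrix p q) (s (-conj u))) =
      hermitian E (symmMatrix p q) (s u) := fun u => by
    rw [← hact (s u), show h (s u) = s (-conj u) from congrFun hhs u]
  refine descends_of_section_symmetric ha hπ hE hs hπs
    (fun r hr => act_conj_section_eq ha hπ hE hs hπs ?_ him hr₂ ?_ hr)
    (fun r hr => act_conj_neg_section_eq ha hπ hE hs hπs him hr₁ hr₁' ?_ hr) x x' hxx'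
  · rw [hermitian_of_eq_one hE₀, reflection_conj_act_symmMatrix]
  · rw [reflection_act]
    ext i j
    fin_cases i <;> fin_cases j <;> simp [boolSign, scalarAut, hconj, h₂]
  · rw [reflection_act]
    ext i j
    fin_cases i <;> fin_cases j <;> simp [boolSign, scalarAut, hconj]
    · linear_combination -h₁
    · linear_combination -h₁

end GenusOneFace

/-! ### Translation to the initial values α, β. -/

namespace GenusOneFace

open Curve

variable {a : ℝ} {X : Type*} [TopologicalSpace X] {π : X → Curve a} {c : ℝ}
  {E F : X → Matrix.SpecialLinearGroup (Fin 2) ℂ}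

theorem satisfiesSU11_iff_descends [SimplyConnectedSpace X] (ha : 1 < a)
    (hπ : IsCoveringMap π) (hE : IsNullLift c (toM ∘ π) E) {x₀ : X} (hE₀ : E x₀ = 1)
    (hF : IsNullLift c (toM ∘ π) F) {ε : ℝ} (hε : ε = 1 ∨ ε = -1) {α β : ℂ}
    (hF₀ : (F x₀).1 = initialP ε α β) :
    SatisfiesSU11 (toM ∘ π) x₀ F ↔ ∀ x x', π x = π x' →
      hermitian E (symmMatrix (‖α‖ ^ 2 - ‖β‖ ^ 2) (‖α‖ ^ 2 + ‖β‖ ^ 2)) x =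
        hermitian E (symmMatrix (‖α‖ ^ 2 - ‖β‖ ^ 2) (‖α‖ ^ 2 + ‖β‖ ^ 2)) x' := by
  have h : ∀ x, hermitian F e₃ x =
      hermitian E (symmMatrix (‖α‖ ^ 2 - ‖β‖ ^ 2) (‖α‖ ^ 2 + ‖β‖ ^ 2)) x := fun x => by
    have h1 := eq_mul_of_isNullLift ha hπ hE hF x₀ x
    rw [hE₀, inv_one, one_mul] at h1
    rw [hermitian, h1, Matrix.SpecialLinearGroup.coe_mul, hF₀, hermitian,
      ← initialP_mul_e₃ hε, Matrix.conjTranspose_mul]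
    simp only [Matrix.mul_assoc]
  rw [satisfiesSU11_iff ha hπ hF]
  simp only [h]

theorem f₁_conj (E : Matrix (Fin 2) (Fin 2) ℂ) : conj (f₁ E) = f₁ E := by
  simp only [f₁, den₁, map_neg, map_div₀, map_add, map_mul, Complex.conj_conj]
  congr 2 <;> ring

theorem sq_sub_sq_eq_one {α β : ℂ} (h : ‖α‖ * ‖β‖ = 1 / 2) :
    (‖α‖ ^ 2 + ‖β‖ ^ 2) ^ 2 - (‖α‖ ^ 2 - ‖β‖ ^ 2) ^ 2 = 1 := by
  linear_combination 4 * (‖α‖ * ‖β‖ + 1 / 2) * h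

theorem exists_initial_values {t : ℝ} (ht : 1 < |t|) :
    ∃ α β : ℂ, α * β = -1 / 2 ∧ ‖α‖ ^ 2 - ‖β‖ ^ 2 ≠ 0 ∧
      (‖α‖ ^ 2 + ‖β‖ ^ 2) / (‖α‖ ^ 2 - ‖β‖ ^ 2) = t := by
  have ht0 : t ≠ 0 := by rintro rfl; norm_num at ht
  have ht1 : 0 < t ^ 2 - 1 := by
    have := one_lt_sq_iff_one_lt_abs t |>.2 ht
    linarith
  set r := √(t ^ 2 - 1) with hr
  have hr0 : 0 < r := Real.sqrt_pos.2 ht1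
  have hr2 : r ^ 2 = t ^ 2 - 1 := Real.sq_sqrt ht1.le
  -- The solution with q > 0 of q / p = t and q² - p² = 1; then |α|² = (q + p)/2 and |β|² = (q -
  -- p)/2.
  set q := |t| / r with hq
  set p := q / t with hp
  have hq0 : 0 < q := div_pos (by linarith) hr0
  have hp0 : p ≠ 0 := div_ne_zero hq0.ne' ht0
  have hpq : q ^ 2 - p ^ 2 = 1 := by
    rw [hp, hq]
    field_simp
    rw [sq_abs, hr2]
    ring
  have habs : |p| < q := by
    rw [← abs_of_pos hq0, ← sq_lt_sq]; linarith
  obtain ⟨h1, h2⟩ := abs_lt.1 habs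
  have hα : (√((q + p) / 2)) ^ 2 = (q + p) / 2 := Real.sq_sqrt (by linarith)
  have hβ : (√((q - p) / 2)) ^ 2 = (q - p) / 2 := Real.sq_sqrt (by linarith)
  have hαβ : √((q + p) / 2) * √((q - p) / 2) = 1 / 2 := by
    rw [← Real.sqrt_mul (by linarith), show (q + p) / 2 * ((q - p) / 2) = (1 / 2) ^ 2 by
      linear_combination hpq / 4, Real.sqrt_sq (by norm_num)]
  refine ⟨((-√((q + p) / 2) : ℝ) : ℂ), (√((q - p) / 2) : ℝ), ?_, ?_, ?_⟩
  · rw [← Complex.ofReal_mul, neg_mul, hαβ]; push_cast; ring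
  all_goals
    rw [Complex.norm_real, Complex.norm_real, Real.norm_eq_abs, Real.norm_eq_abs, sq_abs, sq_abs,
      neg_sq, hα, hβ]
  · rwa [show (q + p) / 2 - (q - p) / 2 = p by ring]
  · rw [show (q + p) / 2 - (q - p) / 2 = p by ring, show (q + p) / 2 + (q - p) / 2 = q by ring,
      hp]
    field_simp

end GenusOneFace

end

/-! ### The main theorem. -/

theorem mainTheorem1 (a c : ℝ) (ha : 1 < a) (hc : c ≠ 0)
    -- the universal covering of `M`, with a base point over `(0, 1)`
    {X : Type*} [TopologicalSpace X] [SimplyConnectedSpace X]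
    (ϖ : X → GenusOneFace.M a) (hϖ : IsCoveringMap ϖ)
    (x₀ : X) (hx₀ : (ϖ x₀).1 = (((0 : ℂ) : OnePoint ℂ), ((1 : ℂ) : OnePoint ℂ)))
    -- the null lift with initial value the identity matrix
    (E : X → Matrix.SpecialLinearGroup (Fin 2) ℂ)
    (hE : GenusOneFace.IsNullLift c ϖ E) (hE₀ : E x₀ = 1)
    -- the curves `c₁`, `c₂` and their lifts
    (c₁ c₂ : C(I, GenusOneFace.M a))
    (hc₁ : GenusOneFace.IsQuadrantCurve c₁)
    (hc₁_end : 1 < (GenusOneFace.zCoord (c₁ 1)).re ∧ (GenusOneFace.zCoord (c₁ 1)).re < a)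
    (hc₂ : GenusOneFace.IsQuadrantCurve c₂)
    (hc₂_end : a < (GenusOneFace.zCoord (c₂ 1)).re)
    (C₁ C₂ : C(I, X)) (hC₁ : ∀ t, ϖ (C₁ t) = c₁ t) (hC₁_zero : C₁ 0 = x₀)
    (hC₂ : ∀ t, ϖ (C₂ t) = c₂ t) (hC₂_zero : C₂ 0 = x₀)
    -- the values of the lift at the end points, and the denominators of `f₁` and `f₂`
    (E₁ E₂ : Matrix (Fin 2) (Fin 2) ℂ) (hE₁ : E₁ = (E (C₁ 1)).1) (hE₂ : E₂ = (E (C₂ 1)).1)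
    (hden₁ : GenusOneFace.den₁ E₁ ≠ 0) (hden₂ : GenusOneFace.den₂ E₂ ≠ 0) :
    -- for given `ε`, `α`, `β`
    (∀ (ε : ℝ) (α β : ℂ), (ε = 1 ∨ ε = -1) → α * β = -ε / 2 →
      ∀ F : X → Matrix.SpecialLinearGroup (Fin 2) ℂ, GenusOneFace.IsNullLift c ϖ F →
        (F x₀).1 = GenusOneFace.initialP ε α β →
        ((GenusOneFace.f₁ E₁ = GenusOneFace.f₂ E₂ ∧ 1 < ‖GenusOneFace.f₁ E₁‖ ∧
            GenusOneFace.f₁ E₁ = (1 + 4 * (‖β‖ : ℂ) ^ 4) / (1 - 4 * (‖β‖ : ℂ) ^ 4)) →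
          GenusOneFace.SatisfiesSU11 ϖ x₀ F) ∧
        ((conj (E₁ 0 0) * E₁ 1 0).re ≠ (conj (E₁ 0 1) * E₁ 1 1).re →
          GenusOneFace.SatisfiesSU11 ϖ x₀ F →
          (GenusOneFace.f₁ E₁ = GenusOneFace.f₂ E₂ ∧ 1 < ‖GenusOneFace.f₁ E₁‖ ∧
            GenusOneFace.f₁ E₁ = (1 + 4 * (‖β‖ : ℂ) ^ 4) / (1 - 4 * (‖β‖ : ℂ) ^ 4)))) ∧
    -- existence of suitable `ε`, `α`, `β`
    ((GenusOneFace.f₁ E₁ = GenusOneFace.f₂ E₂ ∧ 1 < ‖GenusOneFace.f₁ E₁‖) →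
      ∃ (ε : ℝ) (α β : ℂ) (F : X → Matrix.SpecialLinearGroup (Fin 2) ℂ),
        (ε = 1 ∨ ε = -1) ∧ α * β = -ε / 2 ∧ GenusOneFace.IsNullLift c ϖ F ∧
        (F x₀).1 = GenusOneFace.initialP ε α β ∧ GenusOneFace.SatisfiesSU11 ϖ x₀ F) ∧
    ((conj (E₁ 0 0) * E₁ 1 0).re ≠ (conj (E₁ 0 1) * E₁ 1 1).re →
      (∃ (ε : ℝ) (α β : ℂ) (F : X → Matrix.SpecialLinearGroup (Fin 2) ℂ),
        (ε = 1 ∨ ε = -1) ∧ α * β = -ε / 2 ∧ GenusOneFace.IsNullLift c ϖ F ∧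
        (F x₀).1 = GenusOneFace.initialP ε α β ∧ GenusOneFace.SatisfiesSU11 ϖ x₀ F) →
      (GenusOneFace.f₁ E₁ = GenusOneFace.f₂ E₂ ∧ 1 < ‖GenusOneFace.f₁ E₁‖)) := by

  open GenusOneFace GenusOneFace.Curve in
  obtain ⟨π, hπ, rfl⟩ : ∃ π : X → Curve a, IsCoveringMap π ∧ ϖ = toM ∘ π :=
    ⟨(homeo ha).symm ∘ ϖ, hϖ.homeomorph_comp (homeo ha).symm,
      funext fun x => ((homeo ha).apply_symm_apply (ϖ x)).symm⟩
  have hz₀ : z (π x₀) = 0 := congrArg finiteValue (congrArg Prod.fst hx₀)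
  have hw₀ : w (π x₀) = ((1 : ℂ) : OnePoint ℂ) := congrArg Prod.snd hx₀
  have hy₀ : y (π x₀) = -a := by
    rw [y_eq_den_mul, hw₀, hz₀, den]
    change _ * (1 : ℂ) = _
    ring
  have hzero : upperSection a 0 = π x₀ := ext
    (((fold_eq_self_iff 0).2 le_rfl).trans hz₀.symm) ((branchY_zero ha).trans hy₀.symm)
  -- Folding has extended the section to all of ℂ, which is simply connected, so it lifts to X.
  obtain ⟨s, ⟨hs₀, hπs⟩, -⟩ := hπ.existsUnique_continuousMap_lifts
    (⟨upperSection a, continuous_upperSection⟩ : C(ℂ, Curve a)) 0 x₀ hzero.symm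
  replace hπs : ∀ u, π (s u) = upperSection a u := congrFun hπs
  have hlift : ∀ (γ : C(I, M a)), IsQuadrantCurve γ → ∀ (C : C(I, X)),
      (∀ t, (toM ∘ π) (C t) = γ t) → C 0 = x₀ →
        z (π (C 1)) = ((zCoord (γ 1)).re : ℝ) ∧ C 1 = s ((zCoord (γ 1)).re : ℝ) := by
    intro γ hγ C hC hC₀
    have hz : ∀ t, z (π (C t)) = zCoord (γ t) := fun t => congrArg zCoord (hC t)
    have h1 : z (π (C 1)) = ((zCoord (γ 1)).re : ℝ) := by
      rw [hz 1]
      exact Complex.ext rfl (by rw [hγ.end_real]; rfl)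
    refine ⟨h1, ?_⟩
    rw [← h1]
    exact upperSection_eq_lift hπ s.continuous hπs (hC₀.trans hs₀.symm) (by rw [hC₀, hz₀])
      (fun t ht0 ht1 => by rw [hz]; exact (hγ.quadrant t ht0 ht1).2)
      (by rw [hz, hγ.end_real]) ha 1
  obtain ⟨hz₁, hs₁⟩ := hlift c₁ hc₁ C₁ hC₁ hC₁_zero
  obtain ⟨hz₂, hs₂⟩ := hlift c₂ hc₂ C₂ hC₂ hC₂_zero
  have hforward : ∀ p q : ℝ, p ≠ 0 → f₁ E₁ = q / p → f₂ E₂ = q / p → ∀ x x', π x = π x' →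
      hermitian E (symmMatrix p q) x = hermitian E (symmMatrix p q) x' := by
    intro p q hp h1 h2
    rw [f₁_eq_iff hp hden₁, hE₁, hs₁] at h1
    rw [f₂_eq_iff hp hden₂, hE₂, hs₂] at h2
    exact descends_of_period_conditions ha hπ hE s.continuous hπs (by rw [hs₀, hE₀])
      hc₁_end.1.le hc₁_end.2.le hc₂_end.le h1 h2
  have hbackward : ∀ p q : ℝ, q ^ 2 - p ^ 2 = 1 →
      (conj (E₁ 0 0) * E₁ 1 0).re ≠ (conj (E₁ 0 1) * E₁ 1 1).re →
      (∀ x x', π x = π x' →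
        hermitian E (symmMatrix p q) x = hermitian E (symmMatrix p q) x') →
      p ≠ 0 ∧ f₁ E₁ = q / p ∧ f₂ E₂ = q / p := by
    intro p q hpq hne h
    rw [hE₁] at hne
    obtain ⟨h1, h2⟩ := period_conditions_of_descends ha hπ hE hE₀ hz₀ hy₀ hz₁ hc₁_end.1.le
      hc₁_end.2.le hz₂ hc₂_end.le hne h
    have hp : p ≠ 0 := ne_zero_of_sum_eq_zero hpq hden₁ (by rw [hE₁]; exact h1)
    refine ⟨hp, ?_, ?_⟩
    · rw [f₁_eq_iff hp hden₁, hE₁]; exact h1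
    · rw [f₂_eq_iff hp hden₂, hE₂]; exact h2
  have hconverse : ∀ (ε : ℝ) (α β : ℂ), (ε = 1 ∨ ε = -1) → α * β = -ε / 2 →
      ∀ F : X → Matrix.SpecialLinearGroup (Fin 2) ℂ, IsNullLift c (toM ∘ π) F →
      (F x₀).1 = initialP ε α β →
      (conj (E₁ 0 0) * E₁ 1 0).re ≠ (conj (E₁ 0 1) * E₁ 1 1).re →
      SatisfiesSU11 (toM ∘ π) x₀ F → f₁ E₁ = f₂ E₂ ∧ 1 < ‖f₁ E₁‖ ∧
        f₁ E₁ = (1 + 4 * (‖β‖ : ℂ) ^ 4) / (1 - 4 * (‖β‖ : ℂ) ^ 4) := by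
    intro ε α β hε hαβ F hF hF₀ hne hSU
    have hnorm := norm_mul_norm_eq hε hαβ
    have hpq := sq_sub_sq_eq_one hnorm
    obtain ⟨hp, h1, h2⟩ := hbackward _ _ hpq hne
      ((satisfiesSU11_iff_descends ha hπ hE hE₀ hF hε hF₀).1 hSU)
    refine ⟨h1.trans h2.symm, ?_, ?_⟩
    · rw [h1]; exact one_lt_norm_div hp hpq
    · rw [h1]; exact div_eq_of_norm_mul_norm_eq hnorm
  refine ⟨fun ε α β hε hαβ F hF hF₀ => ⟨?_, hconverse ε α β hε hαβ F hF hF₀⟩, ?_, ?_⟩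
  · rintro ⟨h12, hlt, hβ⟩
    have hdiv := div_eq_of_norm_mul_norm_eq (norm_mul_norm_eq hε hαβ)
    rw [← hdiv] at hβ
    rw [satisfiesSU11_iff_descends ha hπ hE hE₀ hF hε hF₀]
    -- If p were 0, the quotient q / p would be 0 by the convention for division, contradicting
    -- absolute value greater than 1.
    refine hforward _ _ (fun hp => ?_) hβ (h12 ▸ hβ)
    rw [hβ, hp, Complex.ofReal_zero, div_zero, norm_zero] at hlt
    exact absurd hlt (by norm_num)
  · rintro ⟨h12, hlt⟩
    -- f₁ is real, as it must be to equal q / p; the sign ε = 1 suffices for existence.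
    obtain ⟨t, ht⟩ := Complex.conj_eq_iff_real.1 (f₁_conj E₁)
    rw [ht, Complex.norm_real, Real.norm_eq_abs] at hlt
    obtain ⟨α, β, hαβ, hp, hq⟩ := exists_initial_values hlt
    have hdet : (initialP 1 α β).det = 1 := by
      rw [initialP, Matrix.det_fin_two_of]; push_cast; linear_combination -2 * hαβ
    let P : Matrix.SpecialLinearGroup (Fin 2) ℂ := ⟨initialP 1 α β, hdet⟩
    have hF := isNullLift_mul_right ha hE P
    have hF₀ : (E x₀ * P).1 = initialP 1 α β := by rw [hE₀, one_mul]
    refine ⟨1, α, β, _, Or.inl rfl, by push_cast; exact hαβ, hF, hF₀, ?_⟩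
    rw [satisfiesSU11_iff_descends ha hπ hE hE₀ hF (Or.inl rfl) hF₀]
    have ht' : f₁ E₁ = ((‖α‖ ^ 2 + ‖β‖ ^ 2 : ℝ) : ℂ) / ((‖α‖ ^ 2 - ‖β‖ ^ 2 : ℝ) : ℂ) := by
      rw [ht, ← hq, Complex.ofReal_div]
    exact hforward _ _ hp ht' (h12 ▸ ht')
  · rintro hne ⟨ε, α, β, F, hε, hαβ, hF, hF₀, hSU⟩
    obtain ⟨h1, h2, -⟩ := hconverse ε α β hε hαβ F hF hF₀ hne hSU
    exact ⟨h1, h2⟩
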